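/- **Setting.** Let $1\le d\le m$ be integers, $\lambda=d/m\in(0,1]$, and let $p$ be a monic real polynomial of degree $d$ all of whose roots $\lambda_1,\dots,\lambda_d$ are real and nonnegative (for instance $p=\chi_{A^TA}$ for a real $m\times d$ matrix $A$). Let $\mu_A=\frac1{2d}\sum_{i=1}^d(\delta_{\sqrt{\lambda_i}}+\delta_{-\sqrt{\lambda_i}})$ be the symmetrized root measure of $p$, and let $R=\max_i\lambda_i$. **Finite $R$-transform.** The $T$-transform of $p$ is the unique multiset $\{t_1,\dots,t_d\}$ of complex numbers with $$\frac1d\sum_{i=1}^d e^{-t_i\partial_x\partial_y}\{y^mx^d\}=y^{m-d}p(xy).$$ The rectangular finite $R$-transform $\mathcal R^{d,\lambda}_{\mu_A}(s)$ is the unique polynomial of degree at most $d$ with $$\mathcal R^{d,\lambda}_{\mu_A}(s)\equiv-\frac1d\,s\frac{d}{ds}\log\Big(\frac1d\sum_{i=1}^d e^{-t_i\,smd}\Big)\mod[s^{d+1}].$$ Here $f\equiv g\mod[s^{n}]$ means that the power series $f$ and $g$ have the same coefficients of $s^0,\dots,s^{n-1}$. **Modified finite $R$-transform.** For $x>\sqrt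 R$ let $\mathcal G(x)=\int\frac{d\mu_A(u)}{x-u}$ and $\mathcal H(x)=\mathcal G(x)\big(\lambda\,\mathcal G(x)+\frac{1-\lambda}{x}\big)$. The function $\mathcal H$ is a bijection from $(\sqrt R,\infty)$ onto $(0,\infty)$; let $\mathcal J$ be its inverse. For $x,y\ge\sqrt R$ let $$\Delta(x,y)=y^{\frac{1-\lambda}{\sqrt\lambda}}\big(p(xy)^{1/d}\big)^{\sqrt\lambda},\qquad F=-\log\Delta,$$ and for $q>0$ let $\|f\|_q=\Big(\int_{\sqrt R}^\infty\!\int_{\sqrt R}^\infty f(x,y)^q\,dx\,dy\Big)^{1/q}$. For $s>0$ put $z=\mathcal J(s^2)$, $r(s)=-\partial_xF(z,z)$, $t(s)=-\partial_yF(z,z)$, and $$\mathcal Q_{\mu_A}(s)=\Big[\frac{\partial}{\partial r}\log\|e^{-xr-yt}\Delta(x,y)\|_{\sqrt{md}}\cdot\frac{\partial}{\partial t}\log\|e^{-xr-yt}\Delta(x,y)\|_{\sqrt{md}}\Big]_{r=r(s),\,t=t(s)},$$ $$\mathcal K_{\mu_A}(s)=\sqrt{\frac1\lambda s^2\mathcal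 Q_{\mu_A}(s)+\frac{(1-\lambda)^2}{4\lambda^2}}.$$ The modified rectangular finite $R$-transform is $\widetilde{\mathcal R}^{d,\lambda}_{\mu_A}(s)=\mathcal K_{\mu_A}(s)-\mathcal K_{\mu_0}(s)$ for $s>0$, where $\mathcal K_{\mu_0}$ is the function obtained in the same way (with the same $m$ and $d$) from the polynomial $x^d$. **Theorem.** For all sufficiently small $s>0$, $\widetilde{\mathcal R}^{d,\lambda}_{\mu_A}(s)$ is the sum of a convergent power series in $s$, and this power series satisfies $$\widetilde{\mathcal R}^{d,\lambda}_{\mu_A}(s)\equiv\mathcal R^{d,\lambda}_{\mu_A}(s^2)\mod[s^{d+1}].$$ -/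

import Mathlib

open MeasureTheory Polynomial PowerSeries

noncomputable section

namespace RectFree

/-! ### Measure, Cauchy transforms and the inverse transform

Throughout, `p` is a monic real polynomial of degree `d ≥ 1` with only nonnegative real roots,
`m ≥ d` is an integer and `lam m d = d / m`. -/

/-- The parameter `λ = d / m ∈ (0, 1]`. -/
def lam (m d : ℕ) : ℝ := (d : ℝ) / (m : ℝ)

/-- The largest root of `p`. -/
def maxRoot (p : ℝ[X]) : ℝ := sSup {x : ℝ | x ∈ p.roots}

/-- The symmetrized root measure `(1 / 2d) ∑ᵢ (δ_{√λᵢ} + δ_{-√λᵢ})`, the sum being over the `d`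
roots `λᵢ` of `p` with multiplicity. -/
def symmMeasure (d : ℕ) (p : ℝ[X]) : Measure ℝ :=
  ((2 * d : ENNReal))⁻¹ •
    (p.roots.map fun x => Measure.dirac (Real.sqrt x) + Measure.dirac (-Real.sqrt x)).sum

/-- The Cauchy transform `G_μ(x) = ∫ dμ(t) / (x - t)`, for real `x` to the right of the support. -/
def cauchyTransform (μ : Measure ℝ) (x : ℝ) : ℝ := ∫ t, 1 / (x - t) ∂μ

/-- The `λ`-rectangular Cauchy transform `H(x) = G(x) (λ G(x) + (1 - λ) / x)`, `x > √(maxRoot p)`. -/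
def rectCauchy (m d : ℕ) (p : ℝ[X]) (x : ℝ) : ℝ :=
  cauchyTransform (symmMeasure d p) x *
    (lam m d * cauchyTransform (symmMeasure d p) x + (1 - lam m d) * (1 / x))

/-- The compositional inverse `J : (0, ∞) → (√(maxRoot p), ∞)` of the rectangular Cauchy
transform. -/
def rectCauchyInv (m d : ℕ) (p : ℝ[X]) : ℝ → ℝ :=
  Function.invFunOn (rectCauchy m d p) (Set.Ioi (Real.sqrt (maxRoot p)))

/-! ### Fuglede-Kadison determinant, `L_q` norms and the modified finite `R`-transform -/

/-- The bivariate Fuglede-Kadison determinant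
`Δ⁺(x, y) = y ^ ((1 - λ) / √λ) * (p(xy) ^ (1 / d)) ^ √λ`. If `p` is the characteristic polynomial
of `Aᵀ A` then `p(xy) = det (xy I - Aᵀ A)`. -/
def fkDet (m d : ℕ) (p : ℝ[X]) (x y : ℝ) : ℝ :=
  y ^ ((1 - lam m d) / Real.sqrt (lam m d)) *
    ((p.eval (x * y)) ^ (1 / (d : ℝ))) ^ Real.sqrt (lam m d)

/-- The Fuglede-Kadison potential `F = - log Δ⁺`. -/
def fkPotential (m d : ℕ) (p : ℝ[X]) (x y : ℝ) : ℝ := -Real.log (fkDet m d p x y)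

/-- The domain `[√R, ∞) × [√R, ∞)`, where `R` is the largest root of `p`. -/
def domainX (p : ℝ[X]) : Set (ℝ × ℝ) :=
  Set.Ici (Real.sqrt (maxRoot p)) ×ˢ Set.Ici (Real.sqrt (maxRoot p))

/-- The `L_q` norm on `S` of a function that is nonnegative on `S`. -/
def lqNorm (S : Set (ℝ × ℝ)) (q : ℝ) (f : ℝ → ℝ → ℝ) : ℝ :=
  (∫ v in S, (f v.1 v.2) ^ q) ^ (1 / q)

/-- `log ‖e^{-xr-yt} Δ⁺(x, y)‖_q` with `q = √(md)`, as a function of `(r, t)`. -/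
def logNorm (m d : ℕ) (p : ℝ[X]) (r t : ℝ) : ℝ :=
  Real.log (lqNorm (domainX p) (Real.sqrt ((m : ℝ) * (d : ℝ)))
    fun x y => Real.exp (-(x * r) - y * t) * fkDet m d p x y)

/-- `r(s) = -∂ₓF(z, z)` with `z = J(s²)`. -/
def rPoint (m d : ℕ) (p : ℝ[X]) (s : ℝ) : ℝ :=
  -deriv (fun x => fkPotential m d p x (rectCauchyInv m d p (s ^ 2))) (rectCauchyInv m d p (s ^ 2))

/-- `t(s) = -∂_yF(z, z)` with `z = J(s²)`. -/
def tPoint (m d : ℕ) (p : ℝ[X]) (s : ℝ) : ℝ :=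
  -deriv (fun y => fkPotential m d p (rectCauchyInv m d p (s ^ 2)) y) (rectCauchyInv m d p (s ^ 2))

/-- The finite inverse rectangular transform `Q(s)`: the product of the two partial derivatives of
`log ‖e^{-xr-yt} Δ⁺(x, y)‖_{√(md)}` at `(r(s), t(s))`. -/
def finiteInv (m d : ℕ) (p : ℝ[X]) (s : ℝ) : ℝ :=
  deriv (fun r => logNorm m d p r (tPoint m d p s)) (rPoint m d p s) *
    deriv (fun t => logNorm m d p (rPoint m d p s) t) (tPoint m d p s)

/-- `K(s) = √(s² Q(s) / λ + (1 - λ)² / (4 λ²))`. -/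
def kTransform (m d : ℕ) (p : ℝ[X]) (s : ℝ) : ℝ :=
  Real.sqrt (1 / lam m d * s ^ 2 * finiteInv m d p s + (1 - lam m d) ^ 2 / (4 * lam m d ^ 2))

/-- The modified rectangular finite `R`-transform `K_{μ_A}(s) - K_{μ_0}(s)` (for `s > 0`), where
`μ_0 = δ_0` is the measure of the polynomial `x ^ d`. -/
def modifiedR (m d : ℕ) (p : ℝ[X]) (s : ℝ) : ℝ :=
  kTransform m d p s - kTransform m d (Polynomial.X ^ d) s

/-! ### The rectangular `T`-transform and the finite `R`-transform -/

/-- The operator `∂ₓ ∂_y` on `ℂ[x, y]`, where `x = X 0` and `y = X 1`. -/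
def dxdy : MvPolynomial (Fin 2) ℂ →ₗ[ℂ] MvPolynomial (Fin 2) ℂ :=
  (MvPolynomial.pderiv (R := ℂ) (0 : Fin 2)).toLinearMap ∘ₗ
    (MvPolynomial.pderiv (R := ℂ) (1 : Fin 2)).toLinearMap

/-- `e^{-τ ∂ₓ∂_y} {y^m x^d}`; the terms of the exponential series of index `k > d` vanish. -/
def expOp (m d : ℕ) (τ : ℂ) : MvPolynomial (Fin 2) ℂ :=
  ∑ k ∈ Finset.range (d + 1), ((-τ) ^ k / (k.factorial : ℂ)) •
    (dxdy ^ k) (MvPolynomial.X 1 ^ m * MvPolynomial.X 0 ^ d)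

/-- `t` is the multiset of the `d` values of the rectangular `T`-transform of `p`, that is
`(1 / d) ∑ᵢ e^{-tᵢ ∂ₓ∂_y} {y^m x^d} = y^{m-d} p(xy)`. -/
def IsTTransform (m d : ℕ) (p : ℝ[X]) (t : Multiset ℂ) : Prop :=
  Multiset.card t = d ∧
    (d : ℂ)⁻¹ • (t.map (expOp m d)).sum =
      MvPolynomial.X 1 ^ (m - d) * Polynomial.aeval (MvPolynomial.X 0 * MvPolynomial.X 1) p

open Classical in
/-- The rectangular `T`-transform of `p`: the unique multiset satisfying `IsTTransform`. -/
def tTransform (m d : ℕ) (p : ℝ[X]) : Multiset ℂ :=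
  if h : ∃ t, IsTTransform m d p t then h.choose else 0

/-- The formal power series `E[e^{-T s m d}] = (1 / d) ∑ᵢ e^{-tᵢ m d s}` in `s`. -/
def laplaceT (m d : ℕ) (p : ℝ[X]) : ℂ⟦X⟧ :=
  (d : ℂ)⁻¹ • ((tTransform m d p).map fun τ =>
    PowerSeries.rescale (-τ * (m : ℂ) * (d : ℂ)) (PowerSeries.exp ℂ)).sum

/-- The rectangular finite `R`-transform: the polynomial of degree at most `d` congruent to
`-(1 / d) s (d/ds) log E[e^{-T s m d}]` modulo `s ^ (d + 1)`. -/
def finiteR (m d : ℕ) (p : ℝ[X]) : ℂ[X] :=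
  PowerSeries.trunc (d + 1)
    ((-(d : ℂ)⁻¹) • (PowerSeries.X * PowerSeries.derivative ℂ
      (PowerSeries.logOf (laplaceT m d p))))

/-! ### Power series expansions and truncated congruences -/

/-- `g` is given, for all small enough `s > 0`, by the convergent power series `f`. -/
def HasExpansion (g : ℝ → ℝ) (f : ℝ⟦X⟧) : Prop :=
  ∃ ε : ℝ, 0 < ε ∧ ∀ s : ℝ, 0 < s → s < ε → HasSum (fun n : ℕ => PowerSeries.coeff n f * s ^ n) (g s)

/-- `f ≡ g mod [s^n]`: the coefficients of index at most `n - 1` agree. -/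
def ModTrunc (n : ℕ) (f g : ℂ⟦X⟧) : Prop := PowerSeries.trunc n f = PowerSeries.trunc n g

end RectFree

end

/-! Put q = √(md) and let ρ be the square root of the largest root. Then Δ^q is the polynomial
y^(m-d) p(xy), so ‖e^{-xr-yt}Δ‖_q^q is a Laplace transform over [ρ,∞)² at (qr, qt). Write p = ∑ c_k
x^(d-k). Integrating term by term gives d! m! / ((qr)^(d+1) (qt)^(m+1)) times Φ = ∑ b_k (q² r t)^k
γ_k, where b_k = c_k (d-k)! (m-k)! / (d! m!) and γ_k is a product of two regularized incomplete
gamma functions (`integral_exp_mul_fkDet`).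

At the saddle point, r(s) t(s) = H(z) = s², and r, t are analytic near 0 and vanish there
(`exists_analytic_points`). Each factor of γ_k is 1 + O(s^(d-k+1)) and is multiplied by s^(2k), so
the lower limit ρ of integration is invisible modulo s^(d+1): Φ ≡ P(s²) with P(w) = ∑ b_k (md w)^k,
and r ∂_r Φ, t ∂_t Φ ≡ s² P'(s²).

On the algebraic side, comparing coefficients in the definition of the T-transform prescribes the
power sums of the t_i, and shows that P is E[e^{-T w md}] modulo w^(d+1) (`coeff_laplaceT`). Hence
the finite R-transform N satisfies d N P + w P' ≡ 0 modulo w^(d+1) (`map_realR`, `X_pow_dvd_realR`),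
and both r ∂_r log Φ and t ∂_t log Φ are ≡ -d N(s²).

The prefactor adds -(d+1) and -(m+1) to these logarithmic derivatives, so s² Q / λ ≡ (dN + d + 1)(dN
+ m + 1) / d². The term (1-λ)²/(4λ²) = (m-d)²/(4d²) completes the square, and K ≡ ((d+m)/2 + 1)/d +
N(s²) (`exists_kTransform_expansion`). For x^d the transform N vanishes, so subtracting K_{μ_0}
removes exactly the constant. -/

namespace RectFree

/-! ### Multisets of complex numbers with prescribed power sums -/

/-- The sequence of elementary symmetric functions determined by the power sums `a 1, a 2, …`
through Newton's identities. -/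
noncomputable def newtonSeq (a : ℕ → ℂ) : ℕ → ℂ
  | 0 => 1
  | k + 1 => ((k : ℂ) + 1)⁻¹ * ((-1) ^ k *
      ∑ i : Fin (k + 1), (-1) ^ (i : ℕ) * newtonSeq a i * a (k + 1 - i))
  decreasing_by exact i.2

theorem newtonSeq_zero (a : ℕ → ℂ) : newtonSeq a 0 = 1 := by rw [newtonSeq]

theorem newtonSeq_succ (a : ℕ → ℂ) (k : ℕ) :
    ((k : ℂ) + 1) * newtonSeq a (k + 1) = (-1) ^ k *
      ∑ i ∈ Finset.range (k + 1), (-1) ^ i * newtonSeq a i * a (k + 1 - i) := by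
  rw [newtonSeq, mul_inv_cancel_left₀ (Nat.cast_add_one_ne_zero k),
    Finset.sum_range fun i => (-1) ^ i * newtonSeq a i * a (k + 1 - i)]

/-- By Vieta, the roots of the monic polynomial with coefficients (-1)^(d-i) e(d-i) work; ℂ is
algebraically closed, so there are d of them. -/
theorem exists_esymm_eq (d : ℕ) (e : ℕ → ℂ) (he : e 0 = 1) :
    ∃ t : Fin d → ℂ, ∀ k ≤ d, (Finset.univ.val.map t).esymm k = e k := by
  set Q : ℂ[X] := Polynomial.X ^ d +
    ∑ i ∈ Finset.range d, Polynomial.C ((-1) ^ (d - i) * e (d - i)) * Polynomial.X ^ i with hQ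
  have hlt : (∑ i ∈ Finset.range d,
      Polynomial.C ((-1) ^ (d - i) * e (d - i)) * Polynomial.X ^ i : ℂ[X]).degree < d := by
    refine (Polynomial.degree_sum_le _ _).trans_lt ?_
    rw [Finset.sup_lt_iff (by exact_mod_cast WithBot.bot_lt_coe d)]
    intro i hi
    refine (Polynomial.degree_C_mul_X_pow_le _ _).trans_lt ?_
    exact_mod_cast Finset.mem_range.1 hi
  have hmonic : Q.Monic := Polynomial.monic_X_pow_add hlt
  have hdeg : Q.natDegree = d := by
    refine Polynomial.natDegree_eq_of_degree_eq_some ?_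
    rw [hQ, Polynomial.degree_add_eq_left_of_degree_lt (by rwa [Polynomial.degree_X_pow]),
      Polynomial.degree_X_pow]
  have hcard : Multiset.card Q.roots = Q.natDegree := IsAlgClosed.card_roots_eq_natDegree
  obtain ⟨l, hl⟩ := Quot.exists_rep Q.roots
  have hl' : Q.roots = (l : Multiset ℂ) := hl.symm
  have hlen : l.length = d := by rw [← hdeg, ← hcard, hl']; simp
  subst hlen
  refine ⟨l.get, fun k hk => ?_⟩
  have hmap : Finset.univ.val.map l.get = Q.roots := by
    rw [hl', Fin.univ_val_map, List.ofFn_get]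
  have hc := Polynomial.coeff_eq_esymm_roots_of_card hcard
    (show l.length - k ≤ Q.natDegree by omega)
  rw [hdeg, hmonic.leadingCoeff, one_mul, Nat.sub_sub_self hk] at hc
  have hc' : Q.coeff (l.length - k) = (-1) ^ k * e k := by
    rw [hQ, Polynomial.coeff_add, Polynomial.finsetSum_coeff, Polynomial.coeff_X_pow]
    simp only [Polynomial.coeff_C_mul_X_pow]
    rcases Nat.eq_zero_or_pos k with rfl | hk0
    · rw [Finset.sum_eq_zero]
      · simp [he]
      · intro i hi
        rw [if_neg]
        have := Finset.mem_range.1 hi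
        omega
    · rw [if_neg (by omega), Finset.sum_eq_single (l.length - k)]
      · simp [Nat.sub_sub_self hk]
      · intro i _ hi
        rw [if_neg (fun h => hi h.symm)]
      · intro h
        exact absurd (Finset.mem_range.2 (by omega)) h
  rw [hc'] at hc
  rw [hmap]
  exact (mul_left_cancel₀ (pow_ne_zero k (by norm_num)) hc).symm

/-- There are `d` complex numbers with arbitrary prescribed power sums of orders `1, …, d`. -/
theorem exists_powerSums_eq (d : ℕ) (a : ℕ → ℂ) :
    ∃ t : Fin d → ℂ, ∀ k, 1 ≤ k → k ≤ d → ∑ i, t i ^ k = a k := by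
  obtain ⟨t, ht⟩ := exists_esymm_eq d (newtonSeq a) (newtonSeq_zero a)
  refine ⟨t, fun k => ?_⟩
  induction k using Nat.strong_induction_on with
  | _ k ih =>
    intro hk1 hkd
    obtain ⟨k, rfl⟩ : ∃ j, k = j + 1 := ⟨k - 1, by omega⟩
    have hN := congrArg (MvPolynomial.aeval t) (MvPolynomial.mul_esymm_eq_sum (Fin d) ℂ (k + 1))
    have hE := newtonSeq_succ a k
    have hset : (Finset.HasAntidiagonal.antidiagonal (k + 1)).filter (fun x => x.1 < k + 1) =
        (Finset.range (k + 1)).image fun i => (i, k + 1 - i) := by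
      ext ⟨i, j⟩
      simp only [Finset.mem_filter, Finset.HasAntidiagonal.mem_antidiagonal, Finset.mem_image, Finset.mem_range,
        Prod.mk.injEq]
      constructor
      · rintro ⟨h1, h2⟩
        exact ⟨i, h2, rfl, by omega⟩
      · rintro ⟨i', h1, rfl, rfl⟩
        omega
    rw [hset, Finset.sum_image (by intro x _ y _ h; exact (Prod.mk.inj h).1)] at hN
    simp only [map_mul, map_sum, map_pow, map_neg, map_one, map_natCast,
      MvPolynomial.aeval_esymm_eq_multiset_esymm, MvPolynomial.psum, MvPolynomial.aeval_X] at hN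
    rw [ht _ hkd] at hN
    push_cast at hN
    have hsign : (-1 : ℂ) ^ (k + 1 + 1) = (-1) ^ k := by ring
    rw [hE, hsign] at hN
    replace hN := mul_left_cancel₀ (pow_ne_zero k (by norm_num)) hN
    -- Newton's identity on both sides: the term i = 0 carries the new power sum with coefficient 1,
    -- and all other terms agree by induction.
    rw [Finset.sum_range_succ', Finset.sum_range_succ'] at hN
    have hrest : ∑ x ∈ Finset.range k, (-1) ^ (x + 1) * newtonSeq a (x + 1) * a (k + 1 - (x + 1)) =
        ∑ x ∈ Finset.range k, (-1) ^ (x + 1) * (Finset.univ.val.map t).esymm (x + 1) *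
          ∑ i, t i ^ (k + 1 - (x + 1)) := by
      refine Finset.sum_congr rfl fun x hx => ?_
      have := Finset.mem_range.1 hx
      rw [ht _ (by omega), ih _ (by omega) (by omega) (by omega)]
    rw [hrest, ht 0 (Nat.zero_le _)] at hN
    simp only [newtonSeq_zero, pow_zero, one_mul, Nat.sub_zero] at hN
    exact (add_left_cancel hN).symm

/-! ### The rectangular `T`-transform -/

/-- The coefficients `c_k (d-k)! (m-k)! / (d! m!)`, where `p = ∑ c_k x^(d-k)`. They are the
coefficients of `E[e^{-T w}]` up to order `d`. -/
noncomputable def momentCoeff (m d : ℕ) (p : ℝ[X]) (k : ℕ) : ℝ :=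
  p.coeff (d - k) * ((d - k).factorial * (m - k).factorial) / (d.factorial * m.factorial)

theorem momentCoeff_zero {m d : ℕ} {p : ℝ[X]} (hp : p.Monic) (hdeg : p.natDegree = d) :
    momentCoeff m d p 0 = 1 := by
  have h : p.coeff d = 1 := by rw [← hdeg]; exact hp
  rw [momentCoeff, Nat.sub_zero, Nat.sub_zero, h, one_mul]
  exact div_self (by positivity)

theorem dxdy_pow_monomial (m d k : ℕ) :
    (dxdy ^ k) (MvPolynomial.X 1 ^ m * MvPolynomial.X 0 ^ d) =
      ((d.descFactorial k * m.descFactorial k : ℕ) : ℂ) •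
        (MvPolynomial.X 1 ^ (m - k) * MvPolynomial.X 0 ^ (d - k)) := by
  induction k with
  | zero => simp
  | succ k ih =>
    rw [pow_succ', Module.End.mul_apply, ih, map_smul]
    have h : dxdy (MvPolynomial.X 1 ^ (m - k) * MvPolynomial.X 0 ^ (d - k)) =
        (((d - k) * (m - k) : ℕ) : ℂ) •
          (MvPolynomial.X 1 ^ (m - (k + 1)) * MvPolynomial.X 0 ^ (d - (k + 1))) := by
      have h1 : MvPolynomial.pderiv (R := ℂ) (1 : Fin 2)
          (MvPolynomial.X 1 ^ (m - k) * MvPolynomial.X 0 ^ (d - k)) =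
          (m - k) • (MvPolynomial.X 1 ^ (m - (k + 1)) * MvPolynomial.X 0 ^ (d - k)) := by
        simp only [Derivation.leibniz, Derivation.leibniz_pow, MvPolynomial.pderiv_X_self,
          MvPolynomial.pderiv_X_of_ne (show (0 : Fin 2) ≠ 1 by decide),
          smul_eq_mul, mul_one, nsmul_eq_mul, ← Nat.sub_sub]
        ring
      have h0 : MvPolynomial.pderiv (R := ℂ) (0 : Fin 2)
          (MvPolynomial.X 1 ^ (m - (k + 1)) * MvPolynomial.X 0 ^ (d - k)) =
          (d - k) • (MvPolynomial.X 1 ^ (m - (k + 1)) * MvPolynomial.X 0 ^ (d - (k + 1))) := by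
        simp only [Derivation.leibniz, Derivation.leibniz_pow, MvPolynomial.pderiv_X_self,
          MvPolynomial.pderiv_X_of_ne (show (1 : Fin 2) ≠ 0 by decide),
          smul_eq_mul, mul_one, nsmul_eq_mul, ← Nat.sub_sub]
        ring
      rw [dxdy, LinearMap.comp_apply, Derivation.coeFn_coe, Derivation.coeFn_coe, h1, map_nsmul,
        h0, smul_smul, Nat.cast_smul_eq_nsmul, mul_comm]
    rw [h, smul_smul, ← Nat.cast_mul, Nat.descFactorial_succ, Nat.descFactorial_succ]
    congr 2
    ring

theorem expOp_eq_sum (m d : ℕ) (τ : ℂ) :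
    expOp m d τ = ∑ k ∈ Finset.range (d + 1),
      ((-τ) ^ k / (k.factorial : ℂ) * ((d.descFactorial k * m.descFactorial k : ℕ) : ℂ)) •
        (MvPolynomial.X 1 ^ (m - k) * MvPolynomial.X 0 ^ (d - k)) := by
  simp only [expOp, dxdy_pow_monomial, smul_smul]

/-- The exponents d - k of x are distinct for k ≤ d, so these monomials are linearly independent. -/
theorem sum_monomials_inj {m d : ℕ} {a b : ℕ → ℂ}
    (h : ∑ k ∈ Finset.range (d + 1), a k •
        (MvPolynomial.X 1 ^ (m - k) * MvPolynomial.X 0 ^ (d - k) : MvPolynomial (Fin 2) ℂ) =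
      ∑ k ∈ Finset.range (d + 1), b k •
        (MvPolynomial.X 1 ^ (m - k) * MvPolynomial.X 0 ^ (d - k))) {k : ℕ} (hk : k ≤ d) :
    a k = b k := by
  have key : ∀ c : ℕ → ℂ, MvPolynomial.coeff
      (Finsupp.single 1 (m - k) + Finsupp.single 0 (d - k))
      (∑ k ∈ Finset.range (d + 1), c k •
        (MvPolynomial.X 1 ^ (m - k) * MvPolynomial.X 0 ^ (d - k) : MvPolynomial (Fin 2) ℂ)) =
        c k := by
    intro c
    rw [MvPolynomial.coeff_sum, Finset.sum_eq_single k]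
    · simp [MvPolynomial.X_pow_eq_monomial, MvPolynomial.monomial_mul]
    · intro j hj hjk
      have hj' := Finset.mem_range.1 hj
      rw [MvPolynomial.X_pow_eq_monomial, MvPolynomial.X_pow_eq_monomial,
        MvPolynomial.monomial_mul, MvPolynomial.coeff_smul, MvPolynomial.coeff_monomial, if_neg,
        smul_zero]
      intro hf
      have := DFunLike.congr_fun hf 0
      simp at this
      omega
    · intro hk'
      exact absurd (Finset.mem_range.2 (by omega)) hk'
  rw [← key a, ← key b, h]

theorem X_pow_mul_aeval_eq_sum {m d : ℕ} (hdm : d ≤ m) {p : ℝ[X]} (hdeg : p.natDegree = d) :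
    (MvPolynomial.X 1 ^ (m - d) * Polynomial.aeval (MvPolynomial.X 0 * MvPolynomial.X 1) p :
      MvPolynomial (Fin 2) ℂ) =
    ∑ k ∈ Finset.range (d + 1), (p.coeff (d - k) : ℂ) •
        (MvPolynomial.X 1 ^ (m - k) * MvPolynomial.X 0 ^ (d - k)) := by
  rw [Polynomial.aeval_eq_sum_range, hdeg, ← Finset.sum_range_reflect, Finset.mul_sum]
  refine Finset.sum_congr rfl fun k hk => ?_
  have hk' := Finset.mem_range.1 hk
  rw [show d + 1 - 1 - k = d - k by omega, show m - k = (m - d) + (d - k) by omega, pow_add,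
    mul_pow, mul_smul_comm, Complex.coe_smul]
  congr 1
  ring

theorem sum_map_expOp {m d : ℕ} (t : Multiset ℂ) :
    (d : ℂ)⁻¹ • (t.map (expOp m d)).sum = ∑ k ∈ Finset.range (d + 1),
      ((d : ℂ)⁻¹ * (t.map fun τ => (-τ) ^ k).sum / (k.factorial : ℂ) *
        ((d.descFactorial k * m.descFactorial k : ℕ) : ℂ)) •
        (MvPolynomial.X 1 ^ (m - k) * MvPolynomial.X 0 ^ (d - k)) := by
  have key : (t.map (expOp m d)).sum = ∑ k ∈ Finset.range (d + 1),
      ((t.map fun τ => (-τ) ^ k).sum / (k.factorial : ℂ) *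
        ((d.descFactorial k * m.descFactorial k : ℕ) : ℂ)) •
        (MvPolynomial.X 1 ^ (m - k) * MvPolynomial.X 0 ^ (d - k)) := by
    induction t using Multiset.induction_on with
    | empty => simp
    | cons τ t ih =>
      rw [Multiset.map_cons, Multiset.sum_cons, ih, expOp_eq_sum, ← Finset.sum_add_distrib]
      refine Finset.sum_congr rfl fun k _ => ?_
      rw [Multiset.map_cons, Multiset.sum_cons, ← add_smul]
      congr 1
      ring
  rw [key, Finset.smul_sum]
  refine Finset.sum_congr rfl fun k _ => ?_
  rw [smul_smul]
  congr 1
  ring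

theorem momentCoeff_mul_descFactorial {m d : ℕ} (hdm : d ≤ m) (p : ℝ[X]) {k : ℕ} (hk : k ≤ d) :
    momentCoeff m d p k * (d.descFactorial k * m.descFactorial k) = p.coeff (d - k) := by
  have h1 := Nat.factorial_mul_descFactorial hk
  have h2 := Nat.factorial_mul_descFactorial (hk.trans hdm)
  rw [momentCoeff, ← h1, ← h2]
  have h3 : (d.descFactorial k : ℝ) ≠ 0 := by
    exact_mod_cast fun h => absurd (Nat.descFactorial_eq_zero_iff_lt.1 h) (by omega)
  have h4 : (m.descFactorial k : ℝ) ≠ 0 := by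
    exact_mod_cast fun h => absurd (Nat.descFactorial_eq_zero_iff_lt.1 h) (by omega)
  push_cast
  field_simp

/-- Both sides of the defining identity are combinations of the monomials y^(m-k) x^(d-k), so the
T-transform is a condition on the power sums of orders at most d only. -/
theorem isTTransform_iff {m d : ℕ} (hdm : d ≤ m) {p : ℝ[X]} (hdeg : p.natDegree = d)
    (t : Multiset ℂ) :
    IsTTransform m d p t ↔ Multiset.card t = d ∧ ∀ k ≤ d,
      (d : ℂ)⁻¹ * (t.map fun τ => (-τ) ^ k).sum / (k.factorial : ℂ) = momentCoeff m d p k := by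
  rw [IsTTransform, sum_map_expOp, X_pow_mul_aeval_eq_sum hdm hdeg]
  refine and_congr_right fun _ => ?_
  have hne : ∀ k ≤ d, ((d.descFactorial k * m.descFactorial k : ℕ) : ℂ) ≠ 0 := by
    intro k hk
    rw [Nat.cast_ne_zero]
    refine mul_ne_zero (fun h => ?_) fun h => ?_ <;>
      exact absurd (Nat.descFactorial_eq_zero_iff_lt.1 h) (by omega)
  have hmc : ∀ k ≤ d, (p.coeff (d - k) : ℂ) =
      momentCoeff m d p k * ((d.descFactorial k * m.descFactorial k : ℕ) : ℂ) := by
    intro k hk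
    rw [← momentCoeff_mul_descFactorial hdm p hk]
    push_cast
    rfl
  constructor
  · intro h k hk
    have := sum_monomials_inj h hk
    rw [hmc k hk] at this
    exact mul_right_cancel₀ (hne k hk) this
  · intro h
    refine Finset.sum_congr rfl fun k hk => ?_
    have hk' : k ≤ d := Nat.lt_succ_iff.1 (Finset.mem_range.1 hk)
    rw [h k hk', hmc k hk']

theorem exists_isTTransform {m d : ℕ} (hd : 0 < d) (hdm : d ≤ m) {p : ℝ[X]} (hp : p.Monic)
    (hdeg : p.natDegree = d) : ∃ t, IsTTransform m d p t := by
  have hd0 : (d : ℂ) ≠ 0 := by exact_mod_cast hd.ne'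
  obtain ⟨t, ht⟩ := exists_powerSums_eq d
    fun k => (-1) ^ k * (d * k.factorial * momentCoeff m d p k)
  refine ⟨Finset.univ.val.map t, (isTTransform_iff hdm hdeg _).2 ⟨by simp, fun k hk => ?_⟩⟩
  have hk0 : (k.factorial : ℂ) ≠ 0 := by exact_mod_cast k.factorial_ne_zero
  have hsum : ((Finset.univ.val.map t).map fun τ => (-τ) ^ k).sum = ∑ i, (-t i) ^ k := by
    rw [Multiset.map_map]; rfl
  rw [hsum]
  -- Order 0 is not among the prescribed power sums; it holds because there are d numbers and p is
  -- monic.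
  rcases Nat.eq_zero_or_pos k with rfl | hk1
  · simp [momentCoeff_zero hp hdeg, hd0]
  · have h1 : ∑ i, (-t i) ^ k = (-1) ^ k * ∑ i, t i ^ k := by
      rw [Finset.mul_sum]
      exact Finset.sum_congr rfl fun i _ => neg_pow _ _
    rw [h1, ht k hk1 hk, ← mul_assoc ((-1 : ℂ) ^ k), ← mul_pow]
    field_simp
    simp

/-- Any multiset selected by `choose` gives these coefficients, so uniqueness of the T-transform is
not needed. -/
theorem coeff_laplaceT {m d : ℕ} (hd : 0 < d) (hdm : d ≤ m) {p : ℝ[X]} (hp : p.Monic)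
    (hdeg : p.natDegree = d) {k : ℕ} (hk : k ≤ d) :
    PowerSeries.coeff k (laplaceT m d p) = ((momentCoeff m d p k * (m * d) ^ k : ℝ) : ℂ) := by
  have h : IsTTransform m d p (tTransform m d p) := by
    have hex := exists_isTTransform hd hdm hp hdeg
    rw [tTransform, dif_pos hex]
    exact hex.choose_spec
  have hm := ((isTTransform_iff hdm hdeg _).1 h).2 k hk
  have hsum : ∀ t : Multiset ℂ, PowerSeries.coeff k (t.map fun τ =>
      PowerSeries.rescale (-τ * (m : ℂ) * (d : ℂ)) (PowerSeries.exp ℂ)).sum =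
        (t.map fun τ => (-τ) ^ k).sum * ((m * d) ^ k / k.factorial) := by
    intro t
    induction t using Multiset.induction_on with
    | empty => simp
    | cons τ t ih =>
      simp only [Multiset.map_cons, Multiset.sum_cons, map_add, ih, PowerSeries.coeff_rescale,
        PowerSeries.coeff_exp]
      simp only [map_div₀, map_one, map_natCast]
      ring
  rw [laplaceT, PowerSeries.coeff_smul, hsum]
  push_cast
  rw [← hm, smul_eq_mul]
  ring

/-! ### The finite `R`-transform as a real polynomial -/

/-- Substitute f - 1 for X in log'(1 + X) · (1 + X) = 1 and apply the chain rule. -/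
theorem derivative_logOf_mul {f : ℂ⟦X⟧} (hf : PowerSeries.constantCoeff f = 1) :
    PowerSeries.derivative ℂ (PowerSeries.logOf f) * f = PowerSeries.derivative ℂ f := by
  have hs : PowerSeries.HasSubst (f - 1) :=
    PowerSeries.HasSubst.of_constantCoeff_zero' (by simp [hf])
  have hgeom : PowerSeries.derivative ℂ (PowerSeries.log ℂ) * (1 + PowerSeries.X) = 1 := by
    rw [PowerSeries.deriv_log, mul_add, mul_one]
    ext n
    rcases n with _ | n
    · simp
    · rw [map_add, PowerSeries.coeff_succ_mul_X, PowerSeries.coeff_mk, PowerSeries.coeff_mk,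
        PowerSeries.coeff_one, if_neg n.succ_ne_zero, pow_succ]
      simp
  have h1 := congrArg (PowerSeries.subst (f - 1)) hgeom
  rw [PowerSeries.subst_mul hs, PowerSeries.subst_add hs, PowerSeries.subst_X hs,
    ← PowerSeries.coe_substAlgHom hs, map_one, add_sub_cancel, PowerSeries.coe_substAlgHom] at h1
  rw [PowerSeries.logOf_eq, PowerSeries.derivative_subst hs, mul_right_comm, h1, one_mul, map_sub,
    PowerSeries.derivative_one, sub_zero]

theorem trunc_eq_iff_dvd {R : Type*} [CommRing R] {n : ℕ} {f g : R⟦X⟧} :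
    PowerSeries.trunc n f = PowerSeries.trunc n g ↔ PowerSeries.X ^ n ∣ f - g := by
  rw [PowerSeries.X_pow_dvd_iff]
  constructor
  · intro h k hk
    have := congrArg (fun q => Polynomial.coeff q k) h
    simpa [PowerSeries.coeff_trunc, hk, sub_eq_zero] using this
  · intro h
    ext k
    simp only [PowerSeries.coeff_trunc]
    split_ifs with hk
    · simpa [sub_eq_zero] using h k hk
    · rfl

/-- The operator s d/ds acts diagonally on powers of s, so it loses no order of vanishing. -/
theorem X_pow_dvd_X_mul_derivative {R : Type*} [CommRing R] {n : ℕ} {f : R⟦X⟧}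
    (h : PowerSeries.X ^ n ∣ f) : PowerSeries.X ^ n ∣ PowerSeries.X * PowerSeries.derivative R f := by
  rw [PowerSeries.X_pow_dvd_iff] at h ⊢
  intro k hk
  rcases k with _ | k
  · simp
  · rw [PowerSeries.coeff_succ_X_mul, PowerSeries.coeff_derivative, h _ hk, zero_mul]

/-- The polynomial `E[e^{-T s m d}] mod s^(d+1)`. -/
noncomputable def laplacePoly (m d : ℕ) (p : ℝ[X]) : ℝ[X] :=
  ∑ k ∈ Finset.range (d + 1), Polynomial.C (momentCoeff m d p k * (m * d) ^ k) * Polynomial.X ^ k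

/-- The finite `R`-transform as a polynomial with real coefficients. -/
noncomputable def realR (m d : ℕ) (p : ℝ[X]) : ℝ[X] :=
  PowerSeries.trunc (d + 1) (-(d : ℝ)⁻¹ • (PowerSeries.X *
    (PowerSeries.derivative ℝ (laplacePoly m d p : ℝ⟦X⟧) * (laplacePoly m d p : ℝ⟦X⟧)⁻¹)))

theorem coeff_laplacePoly (m d : ℕ) (p : ℝ[X]) {k : ℕ} (hk : k ≤ d) :
    (laplacePoly m d p).coeff k = momentCoeff m d p k * (m * d) ^ k := by
  simp only [laplacePoly, Polynomial.finsetSum_coeff, Polynomial.coeff_C_mul_X_pow]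
  simp [Nat.lt_succ_iff.2 hk]

theorem constantCoeff_laplacePoly {m d : ℕ} {p : ℝ[X]} (hp : p.Monic) (hdeg : p.natDegree = d) :
    PowerSeries.constantCoeff (laplacePoly m d p : ℝ⟦X⟧) = 1 := by
  rw [← PowerSeries.coeff_zero_eq_constantCoeff_apply, Polynomial.coeff_coe,
    coeff_laplacePoly _ _ _ (Nat.zero_le _), momentCoeff_zero hp hdeg]
  simp

/-- The definition of the R-transform with the denominator cleared; the analytic part uses it in
this polynomial form. -/
theorem X_pow_dvd_realR {m d : ℕ} (hd : 0 < d) {p : ℝ[X]} (hp : p.Monic)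
    (hdeg : p.natDegree = d) :
    (Polynomial.X : ℝ[X]) ^ (d + 1) ∣ Polynomial.C (d : ℝ) * realR m d p * laplacePoly m d p +
      Polynomial.X * Polynomial.derivative (laplacePoly m d p) := by
  have h0 := constantCoeff_laplacePoly (m := m) hp hdeg
  have hd0 : (d : ℝ) ≠ 0 := by exact_mod_cast hd.ne'
  have hps : (PowerSeries.X : ℝ⟦X⟧) ^ (d + 1) ∣
      ((Polynomial.C (d : ℝ) * realR m d p * laplacePoly m d p +
      Polynomial.X * Polynomial.derivative (laplacePoly m d p) : ℝ[X]) : ℝ⟦X⟧) := by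
    have ht : PowerSeries.trunc (d + 1) (realR m d p : ℝ⟦X⟧) = PowerSeries.trunc (d + 1) _ :=
      PowerSeries.trunc_trunc _
    have h1 := (trunc_eq_iff_dvd.1 ht).mul_left
      (PowerSeries.C (d : ℝ) * (laplacePoly m d p : ℝ⟦X⟧))
    have hinv := PowerSeries.mul_inv_cancel (laplacePoly m d p : ℝ⟦X⟧) (by rw [h0]; exact one_ne_zero)
    have hC : PowerSeries.C (d : ℝ) * PowerSeries.C (d : ℝ)⁻¹ = 1 := by
      rw [← map_mul, mul_inv_cancel₀ hd0, map_one]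
    convert h1 using 1
    simp only [Polynomial.coe_add, Polynomial.coe_mul, Polynomial.coe_C, Polynomial.coe_X,
      ← PowerSeries.derivative_coe, neg_smul, PowerSeries.smul_eq_C_mul]
    linear_combination (-(PowerSeries.X * PowerSeries.derivative ℝ (laplacePoly m d p : ℝ⟦X⟧))) *
        hinv - (PowerSeries.X * PowerSeries.derivative ℝ (laplacePoly m d p : ℝ⟦X⟧)) *
        (laplacePoly m d p : ℝ⟦X⟧) * (laplacePoly m d p : ℝ⟦X⟧)⁻¹ * hC
  rw [Polynomial.X_pow_dvd_iff]
  intro k hk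
  rw [← Polynomial.coeff_coe]
  exact PowerSeries.X_pow_dvd_iff.1 hps k hk

theorem map_realR {m d : ℕ} (hd : 0 < d) (hdm : d ≤ m) {p : ℝ[X]} (hp : p.Monic)
    (hdeg : p.natDegree = d) : (realR m d p).map Complex.ofRealHom = finiteR m d p := by
  set H : ℂ⟦X⟧ := PowerSeries.map Complex.ofRealHom (laplacePoly m d p : ℝ⟦X⟧) with hH
  have hH0 : PowerSeries.constantCoeff H = 1 := by
    rw [hH, ← PowerSeries.coeff_zero_eq_constantCoeff_apply, PowerSeries.coeff_map,
      PowerSeries.coeff_zero_eq_constantCoeff_apply, constantCoeff_laplacePoly hp hdeg, map_one]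
  have hHinv := PowerSeries.mul_inv_cancel H (by rw [hH0]; exact one_ne_zero)
  have hdvd : PowerSeries.X ^ (d + 1) ∣ laplaceT m d p - H := by
    rw [PowerSeries.X_pow_dvd_iff]
    intro k hk
    have hk' : k ≤ d := Nat.lt_succ_iff.1 hk
    rw [map_sub, coeff_laplaceT hd hdm hp hdeg hk', hH, PowerSeries.coeff_map,
      Polynomial.coeff_coe, coeff_laplacePoly _ _ _ hk']
    simp
  have hL0 : PowerSeries.constantCoeff (laplaceT m d p) = 1 := by
    rw [← PowerSeries.coeff_zero_eq_constantCoeff_apply,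
      coeff_laplaceT hd hdm hp hdeg (Nat.zero_le _), momentCoeff_zero hp hdeg]
    simp
  have hlog := derivative_logOf_mul hL0
  have hLinv := PowerSeries.mul_inv_cancel (laplaceT m d p) (by rw [hL0]; exact one_ne_zero)
  have hderiv : PowerSeries.map Complex.ofRealHom
      (PowerSeries.derivative ℝ (laplacePoly m d p : ℝ⟦X⟧)) = PowerSeries.derivative ℂ H := by
    ext k
    rw [PowerSeries.coeff_map, PowerSeries.coeff_derivative, PowerSeries.coeff_derivative, hH,
      PowerSeries.coeff_map]
    simp
  have hinv : PowerSeries.map Complex.ofRealHom (laplacePoly m d p : ℝ⟦X⟧)⁻¹ = H⁻¹ := by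
    have h1 := congrArg (PowerSeries.map Complex.ofRealHom) (PowerSeries.mul_inv_cancel
      (laplacePoly m d p : ℝ⟦X⟧) (by rw [constantCoeff_laplacePoly hp hdeg]; exact one_ne_zero))
    rw [map_mul, map_one, ← hH] at h1
    calc _ = H⁻¹ * (H * PowerSeries.map Complex.ofRealHom (laplacePoly m d p : ℝ⟦X⟧)⁻¹) := by
          rw [← mul_assoc, mul_comm H⁻¹, hHinv, one_mul]
      _ = _ := by rw [h1, mul_one]
  rw [realR, ← PowerSeries.trunc_map, finiteR, trunc_eq_iff_dvd]
  simp only [PowerSeries.smul_eq_C_mul, map_mul, PowerSeries.map_C, PowerSeries.map_X, hderiv, hinv]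
  have hE := X_pow_dvd_X_mul_derivative hdvd
  rw [map_sub] at hE
  -- With L = `laplaceT m d p`: X H' (L - H) - H (X L' - X H') = X (H' L - H L'), which after
  -- division by H L is the difference of the logarithmic derivatives.
  have hcomb := ((hdvd.mul_left (PowerSeries.X * PowerSeries.derivative ℂ H)).sub
    (hE.mul_left H)).mul_left (PowerSeries.C (-(d : ℂ)⁻¹) * H⁻¹ * (laplaceT m d p)⁻¹)
  convert hcomb using 1
  have hlog' : PowerSeries.derivative ℂ (PowerSeries.logOf (laplaceT m d p)) =
      PowerSeries.derivative ℂ (laplaceT m d p) * (laplaceT m d p)⁻¹ := by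
    rw [← hlog, mul_assoc, hLinv, mul_one]
  have hC : Complex.ofRealHom (-(d : ℝ)⁻¹) = -(d : ℂ)⁻¹ := by simp
  rw [hlog', hC]
  linear_combination
    -(PowerSeries.C (-(d : ℂ)⁻¹) * PowerSeries.X * PowerSeries.derivative ℂ H * H⁻¹) * hLinv +
    (PowerSeries.C (-(d : ℂ)⁻¹) * PowerSeries.X * PowerSeries.derivative ℂ (laplaceT m d p) *
      (laplaceT m d p)⁻¹) * hHinv

theorem realR_X_pow {m d : ℕ} : realR m d (Polynomial.X ^ d) = 0 := by
  have h : laplacePoly m d (Polynomial.X ^ d) = Polynomial.C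
      (momentCoeff m d (Polynomial.X ^ d) 0) := by
    rw [laplacePoly, Finset.sum_eq_single 0]
    · simp
    · intro k hk hk0
      have := Finset.mem_range.1 hk
      rw [momentCoeff, Polynomial.coeff_X_pow, if_neg (by omega)]
      simp
    · simp
  rw [realR, h, PowerSeries.derivative_coe]
  simp

/-! ### Upper incomplete gamma functions of integer order -/

/-- The regularized upper incomplete gamma function `Γ(n + 1, x) / n! = e^{-x} ∑_{j ≤ n} x^j / j!`. -/
noncomputable def gammaTail (n : ℕ) (x : ℝ) : ℝ :=
  Real.exp (-x) * ∑ j ∈ Finset.range (n + 1), x ^ j / j.factorial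

theorem hasDerivAt_sum_pow_div_factorial (n : ℕ) (x : ℝ) :
    HasDerivAt (fun y : ℝ => ∑ j ∈ Finset.range (n + 1), y ^ j / (j.factorial : ℝ))
      (∑ j ∈ Finset.range n, x ^ j / (j.factorial : ℝ)) x := by
  induction n with
  | zero => simpa using hasDerivAt_const x (1 : ℝ)
  | succ n ih =>
    simp only [fun y : ℝ => Finset.sum_range_succ (fun j => y ^ j / (j.factorial : ℝ)) (n + 1)]
    refine (ih.add ((hasDerivAt_pow (n + 1) x).div_const ((n + 1).factorial : ℝ))).congr_deriv ?_
    rw [Finset.sum_range_succ _ n, Nat.factorial_succ, Nat.add_sub_cancel]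
    congr 1
    push_cast
    field_simp

theorem hasDerivAt_gammaTail (n : ℕ) (x : ℝ) :
    HasDerivAt (gammaTail n) (-(Real.exp (-x) * (x ^ n / n.factorial))) x := by
  have h := ((hasDerivAt_neg x).exp).mul (hasDerivAt_sum_pow_div_factorial n x)
  refine h.congr_deriv ?_
  rw [Finset.sum_range_succ]
  ring

theorem tendsto_gammaTail (n : ℕ) : Filter.Tendsto (gammaTail n) Filter.atTop (nhds 0) := by
  have h : Filter.Tendsto (fun x : ℝ => ∑ j ∈ Finset.range (n + 1),
      (x ^ j * Real.exp (-x)) * ((j.factorial : ℝ))⁻¹) Filter.atTop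
      (nhds (∑ j ∈ Finset.range (n + 1), 0 * ((j.factorial : ℝ))⁻¹)) :=
    tendsto_finsetSum _ fun j _ =>
      (Real.tendsto_pow_mul_exp_neg_atTop_nhds_zero j).mul_const _
  simp only [zero_mul, Finset.sum_const_zero] at h
  refine h.congr fun x => ?_
  rw [gammaTail, Finset.mul_sum]
  exact Finset.sum_congr rfl fun j _ => by ring

/-- `gammaTail n x - 1` is -e^{-x} times the Taylor remainder of e^x after degree n. -/
theorem gammaTail_sub_one_isBigO (n : ℕ) :
    (fun x => gammaTail n x - 1) =O[nhds 0] fun x => x ^ (n + 1) := by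
  have h1 := Real.exp_sub_sum_range_isBigO_pow (n + 1)
  have h2 : (fun x : ℝ => -Real.exp (-x)) =O[nhds 0] fun _ => (1 : ℝ) :=
    (Continuous.tendsto (by fun_prop) 0).isBigO_one ℝ
  refine ((h2.mul h1).congr (fun x => ?_) fun x => one_mul _)
  have h3 : Real.exp (-x) * Real.exp x = 1 := by rw [← Real.exp_add]; simp
  rw [gammaTail]
  linear_combination -h3

theorem analyticAt_gammaTail (n : ℕ) (x : ℝ) : AnalyticAt ℝ (gammaTail n) x := by
  unfold gammaTail
  fun_prop

/-- This antiderivative vanishes at infinity, which yields both the integrability and the value of ∫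
x^n e^{-cx} over a half-line. -/
theorem hasDerivAt_gammaTail_scaled (n : ℕ) {c : ℝ} (hc : 0 < c) (x : ℝ) :
    HasDerivAt (fun x => -(n.factorial / c ^ (n + 1)) * gammaTail n (c * x))
      (x ^ n * Real.exp (-(c * x))) x := by
  have h := ((hasDerivAt_gammaTail n (c * x)).comp x ((hasDerivAt_id x).const_mul c)).const_mul
    (-((n.factorial : ℝ) / c ^ (n + 1)))
  refine h.congr_deriv ?_
  rw [mul_pow, pow_succ]
  field_simp

theorem tendsto_gammaTail_scaled (n : ℕ) {c : ℝ} (hc : 0 < c) :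
    Filter.Tendsto (fun x => -(n.factorial / c ^ (n + 1)) * gammaTail n (c * x))
      Filter.atTop (nhds 0) := by
  simpa using ((tendsto_gammaTail n).comp
    (Filter.tendsto_id.const_mul_atTop hc)).const_mul (-((n.factorial : ℝ) / c ^ (n + 1)))

theorem integrableOn_pow_mul_exp (n : ℕ) {c ρ : ℝ} (hc : 0 < c) (hρ : 0 ≤ ρ) :
    IntegrableOn (fun x => x ^ n * Real.exp (-(c * x))) (Set.Ici ρ) := by
  rw [integrableOn_Ici_iff_integrableOn_Ioi]
  exact integrableOn_Ioi_deriv_of_nonneg' (fun x _ => hasDerivAt_gammaTail_scaled n hc x)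
    (fun x hx => mul_nonneg (pow_nonneg (hρ.trans (le_of_lt hx)) _) (Real.exp_pos _).le)
    (tendsto_gammaTail_scaled n hc)

theorem integral_pow_mul_exp (n : ℕ) {c ρ : ℝ} (hc : 0 < c) (hρ : 0 ≤ ρ) :
    ∫ x in Set.Ici ρ, x ^ n * Real.exp (-(c * x)) =
      n.factorial / c ^ (n + 1) * gammaTail n (c * ρ) := by
  rw [integral_Ici_eq_integral_Ioi,
    integral_Ioi_of_hasDerivAt_of_nonneg' (fun x _ => hasDerivAt_gammaTail_scaled n hc x)
      (fun x hx => mul_nonneg (pow_nonneg (hρ.trans (le_of_lt hx)) _) (Real.exp_pos _).le)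
      (tendsto_gammaTail_scaled n hc)]
  ring

theorem integral_sum_prod (N : ℕ) (a : ℕ → ℝ) (f g : ℕ → ℝ → ℝ) {s t : Set ℝ}
    (hf : ∀ k, IntegrableOn (f k) s) (hg : ∀ k, IntegrableOn (g k) t) :
    ∫ v in s ×ˢ t, ∑ k ∈ Finset.range N, a k * (f k v.1 * g k v.2) =
      ∑ k ∈ Finset.range N, a k * ((∫ x in s, f k x) * ∫ y in t, g k y) := by
  rw [integral_finsetSum]
  · refine Finset.sum_congr rfl fun k _ => ?_
    rw [integral_const_mul, Measure.volume_eq_prod, setIntegral_prod_mul]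
  · intro k _
    rw [Measure.volume_eq_prod, ← Measure.prod_restrict]
    exact ((hf k).mul_prod (hg k)).const_mul _

/-! ### The Laplace transform of the determinant -/

/-- The normalized Laplace transform `∑_k b_k (q² r t)^k Γ(n₁-k+1, qρr) Γ(n₂-k+1, qρt)`, with
regularized incomplete gamma functions. -/
noncomputable def normLaplace (b : ℕ → ℝ) (N n₁ n₂ : ℕ) (q ρ r t : ℝ) : ℝ :=
  ∑ k ∈ Finset.range (N + 1), b k * (q ^ 2 * (r * t)) ^ k *
    (gammaTail (n₁ - k) (q * ρ * r) * gammaTail (n₂ - k) (q * ρ * t))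

/-- The derivative of `normLaplace` in its first variable, multiplied by that variable. -/
noncomputable def normLaplaceDeriv (b : ℕ → ℝ) (N n₁ n₂ : ℕ) (q ρ r t : ℝ) : ℝ :=
  ∑ k ∈ Finset.range (N + 1), b k * (q ^ 2 * (r * t)) ^ k *
    ((k * gammaTail (n₁ - k) (q * ρ * r) -
      Real.exp (-(q * ρ * r)) * ((q * ρ * r) ^ (n₁ - k + 1) / (n₁ - k).factorial)) *
        gammaTail (n₂ - k) (q * ρ * t))

/-- Turns the derivative in t into the derivative in the first variable with n₁ and n₂ exchanged. -/
theorem normLaplace_swap (b : ℕ → ℝ) (N n₁ n₂ : ℕ) (q ρ r t : ℝ) :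
    normLaplace b N n₁ n₂ q ρ r t = normLaplace b N n₂ n₁ q ρ t r := by
  simp only [normLaplace, mul_comm r t]
  exact Finset.sum_congr rfl fun k _ => by ring

theorem hasDerivAt_normLaplace (b : ℕ → ℝ) (N n₁ n₂ : ℕ) (q ρ : ℝ) {r : ℝ} (hr : r ≠ 0) (t : ℝ) :
    HasDerivAt (fun r => normLaplace b N n₁ n₂ q ρ r t)
      (normLaplaceDeriv b N n₁ n₂ q ρ r t / r) r := by
  rw [normLaplaceDeriv, Finset.sum_div]
  refine HasDerivAt.fun_sum fun k _ => ?_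
  have h1 : HasDerivAt (fun r : ℝ => (q ^ 2 * (r * t)) ^ k) (k * (q ^ 2 * (r * t)) ^ k / r) r := by
    refine ((((hasDerivAt_id r).mul_const t).const_mul (q ^ 2)).pow k).congr_deriv ?_
    rcases k with _ | k
    · simp
    · rw [Nat.add_sub_cancel, pow_succ]
      simp only [id]
      field_simp
      ring
  have h2 : HasDerivAt (fun r : ℝ => gammaTail (n₁ - k) (q * ρ * r))
      (-(Real.exp (-(q * ρ * r)) * ((q * ρ * r) ^ (n₁ - k) / (n₁ - k).factorial)) * (q * ρ)) r := by
    have := (hasDerivAt_gammaTail (n₁ - k) (q * ρ * r)).comp r ((hasDerivAt_id r).const_mul (q * ρ))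
    exact this.congr_deriv (by rw [mul_one])
  refine ((h1.const_mul (b k)).mul (h2.mul_const (gammaTail (n₂ - k) (q * ρ * t)))).congr_deriv ?_
  rw [pow_succ (q * ρ * r)]
  field_simp
  ring

/-! ### Roots -/

theorem bddAbove_roots (p : ℝ[X]) : BddAbove {x : ℝ | x ∈ p.roots} := by
  refine (Set.Finite.subset p.roots.toFinset.finite_toSet ?_).bddAbove
  intro x hx
  simpa using hx

theorem le_maxRoot {p : ℝ[X]} {x : ℝ} (hx : x ∈ p.roots) : x ≤ maxRoot p :=
  le_csSup (bddAbove_roots p) hx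

theorem maxRoot_nonneg {p : ℝ[X]} (hroots : ∀ x ∈ p.roots, 0 ≤ x) : 0 ≤ maxRoot p :=
  Real.sSup_nonneg hroots

theorem eval_nonneg_of_maxRoot_le {p : ℝ[X]} (hp : p.Monic) (hsplit : p.Splits) {w : ℝ}
    (hw : maxRoot p ≤ w) : 0 ≤ p.eval w := by
  rw [hsplit.eval_eq_prod_roots_of_monic hp]
  refine Multiset.prod_nonneg fun y hy => ?_
  obtain ⟨x, hx, rfl⟩ := Multiset.mem_map.1 hy
  exact sub_nonneg.2 ((le_maxRoot hx).trans hw)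

theorem eval_pos_of_maxRoot_lt {p : ℝ[X]} (hp : p.Monic) (hsplit : p.Splits) {w : ℝ}
    (hw : maxRoot p < w) : 0 < p.eval w := by
  refine lt_of_le_of_ne (eval_nonneg_of_maxRoot_le hp hsplit hw.le) fun h => ?_
  have : w ∈ p.roots := (Polynomial.mem_roots hp.ne_zero).2 h.symm
  exact absurd (le_maxRoot this) (not_le.2 hw)

theorem maxRoot_le_mul {p : ℝ[X]} (hroots : ∀ x ∈ p.roots, 0 ≤ x) {x y : ℝ}
    (hx : Real.sqrt (maxRoot p) ≤ x) (hy : Real.sqrt (maxRoot p) ≤ y) : maxRoot p ≤ x * y := by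
  rw [← Real.mul_self_sqrt (maxRoot_nonneg hroots)]
  exact mul_le_mul hx hy (Real.sqrt_nonneg _) ((Real.sqrt_nonneg _).trans hx)

/-! ### The norm as a Laplace transform -/

section Exponents

variable {m d : ℕ} (hd : 0 < d) (hdm : d ≤ m)
include hd hdm

theorem lam_pos : 0 < lam m d :=
  div_pos (by exact_mod_cast hd) (by exact_mod_cast hd.trans_le hdm)

theorem lam_mul : lam m d * m = d := by
  have : (m : ℝ) ≠ 0 := by exact_mod_cast (hd.trans_le hdm).ne'
  rw [lam]
  field_simp

theorem sqrt_mul_pos : 0 < Real.sqrt ((m : ℝ) * d) :=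
  Real.sqrt_pos.2 (mul_pos (by exact_mod_cast hd.trans_le hdm) (by exact_mod_cast hd))

theorem sqrt_mul_eq : Real.sqrt ((m : ℝ) * d) = Real.sqrt (lam m d) * m := by
  rw [Real.sqrt_eq_iff_mul_self_eq (by positivity) (by positivity)]
  rw [mul_mul_mul_comm, Real.mul_self_sqrt (lam_pos hd hdm).le, ← mul_assoc, lam_mul hd hdm]
  ring

theorem exponent_y : (1 - lam m d) / Real.sqrt (lam m d) * Real.sqrt ((m : ℝ) * d) =
    ((m - d : ℕ) : ℝ) := by
  have h := Real.sqrt_pos.2 (lam_pos hd hdm)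
  rw [sqrt_mul_eq hd hdm, Nat.cast_sub hdm, ← lam_mul hd hdm]
  field_simp

theorem exponent_p : 1 / (d : ℝ) * Real.sqrt (lam m d) * Real.sqrt ((m : ℝ) * d) = 1 := by
  have hd0 : (d : ℝ) ≠ 0 := by exact_mod_cast hd.ne'
  rw [sqrt_mul_eq hd hdm, mul_assoc, ← mul_assoc (Real.sqrt _),
    Real.mul_self_sqrt (lam_pos hd hdm).le, lam_mul hd hdm]
  field_simp

/-- The choice q = √(md) is what makes both exponents integers, m - d and 1. -/
theorem fkDet_rpow {p : ℝ[X]} {x y : ℝ} (hy : 0 ≤ y) (hxy : 0 ≤ p.eval (x * y)) :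
    fkDet m d p x y ^ Real.sqrt ((m : ℝ) * d) = y ^ (m - d) * p.eval (x * y) := by
  rw [fkDet, Real.mul_rpow (Real.rpow_nonneg hy _)
    (Real.rpow_nonneg (Real.rpow_nonneg hxy _) _), ← Real.rpow_mul hy, exponent_y hd hdm,
    Real.rpow_natCast, ← Real.rpow_mul hxy, ← Real.rpow_mul hxy, exponent_p hd hdm, Real.rpow_one]

end Exponents

theorem pow_mul_eval_eq_sum {m d : ℕ} (hdm : d ≤ m) {p : ℝ[X]} (hdeg : p.natDegree = d)
    (x y : ℝ) : y ^ (m - d) * p.eval (x * y) =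
      ∑ k ∈ Finset.range (d + 1), p.coeff (d - k) * (x ^ (d - k) * y ^ (m - k)) := by
  rw [Polynomial.eval_eq_sum_range, hdeg, ← Finset.sum_range_reflect, Finset.mul_sum]
  refine Finset.sum_congr rfl fun k hk => ?_
  have hk' := Finset.mem_range.1 hk
  rw [show d + 1 - 1 - k = d - k by omega, show m - k = (m - d) + (d - k) by omega, pow_add,
    mul_pow]
  ring

/-- Each monomial x^(d-k) y^(m-k) integrates to a product of two incomplete gamma functions. Pulling
the powers (qr)^(d+1) (qt)^(m+1) out of every term leaves the factor (q² r t)^k. -/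
theorem integral_exp_mul_fkDet {m d : ℕ} (hd : 0 < d) (hdm : d ≤ m) {p : ℝ[X]} (hp : p.Monic)
    (hdeg : p.natDegree = d) (hsplit : p.Splits) (hroots : ∀ x ∈ p.roots, 0 ≤ x) {r t : ℝ}
    (hr : 0 < r) (ht : 0 < t) :
    ∫ v in domainX p, (Real.exp (-(v.1 * r) - v.2 * t) * fkDet m d p v.1 v.2) ^
        Real.sqrt ((m : ℝ) * d) =
      d.factorial * m.factorial /
        ((Real.sqrt ((m : ℝ) * d) * r) ^ (d + 1) * (Real.sqrt ((m : ℝ) * d) * t) ^ (m + 1)) *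
        normLaplace (momentCoeff m d p) d d m (Real.sqrt ((m : ℝ) * d)) (Real.sqrt (maxRoot p))
          r t := by
  set q := Real.sqrt ((m : ℝ) * d) with hq
  set ρ := Real.sqrt (maxRoot p) with hρ
  have hq0 : 0 < q := sqrt_mul_pos hd hdm
  have hρ0 : 0 ≤ ρ := Real.sqrt_nonneg _
  have hmeas : MeasurableSet (domainX p) := measurableSet_Ici.prod measurableSet_Ici
  have h1 : ∫ v in domainX p, (Real.exp (-(v.1 * r) - v.2 * t) * fkDet m d p v.1 v.2) ^ q =
      ∫ v in domainX p, ∑ k ∈ Finset.range (d + 1), p.coeff (d - k) *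
        ((v.1 ^ (d - k) * Real.exp (-(q * r * v.1))) *
          (v.2 ^ (m - k) * Real.exp (-(q * t * v.2)))) := by
    refine setIntegral_congr_fun hmeas fun v hv => ?_
    have hx : ρ ≤ v.1 := hv.1
    have hy : ρ ≤ v.2 := hv.2
    have hy0 : 0 ≤ v.2 := hρ0.trans hy
    have he := eval_nonneg_of_maxRoot_le hp hsplit (maxRoot_le_mul hroots hx hy)
    have hnn : 0 ≤ fkDet m d p v.1 v.2 := by
      rw [fkDet]
      positivity
    rw [Real.mul_rpow (Real.exp_pos _).le hnn, hq, fkDet_rpow hd hdm hy0 he,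
      pow_mul_eval_eq_sum hdm hdeg, ← Real.exp_mul, Finset.mul_sum, ← hq]
    refine Finset.sum_congr rfl fun k _ => ?_
    rw [show (-(v.1 * r) - v.2 * t) * q = -(q * r * v.1) + -(q * t * v.2) by ring, Real.exp_add]
    ring
  rw [h1, domainX, integral_sum_prod (d + 1) (fun k => p.coeff (d - k))
    (fun k x => x ^ (d - k) * Real.exp (-(q * r * x)))
    (fun k y => y ^ (m - k) * Real.exp (-(q * t * y)))
    (fun k => integrableOn_pow_mul_exp _ (mul_pos hq0 hr) hρ0)
    (fun k => integrableOn_pow_mul_exp _ (mul_pos hq0 ht) hρ0), normLaplace, Finset.mul_sum]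
  refine Finset.sum_congr rfl fun k hk => ?_
  have hk' : k ≤ d := Nat.lt_succ_iff.1 (Finset.mem_range.1 hk)
  rw [integral_pow_mul_exp _ (mul_pos hq0 hr) hρ0, integral_pow_mul_exp _ (mul_pos hq0 ht) hρ0,
    momentCoeff, show d + 1 = (d - k + 1) + k by omega, show m + 1 = (m - k + 1) + k by omega,
    pow_add (q * r) (d - k + 1) k,
    pow_add (q * t) (m - k + 1) k, mul_right_comm q r, mul_right_comm q t]
  rw [show q ^ 2 * (r * t) = (q * r) * (q * t) by ring, mul_pow (q * r) (q * t) k]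
  have hqr := (mul_pos hq0 hr).ne'
  have hqt := (mul_pos hq0 ht).ne'
  -- Powers with truncated exponents become independent nonzero atoms for `field_simp`.
  generalize q * r = a at *
  generalize q * t = b at *
  have := (pow_ne_zero k hqr)
  have := (pow_ne_zero k hqt)
  have := (pow_ne_zero (d - k + 1) hqr)
  have := (pow_ne_zero (m - k + 1) hqt)
  have hdf : (d.factorial : ℝ) ≠ 0 := by exact_mod_cast d.factorial_ne_zero
  have hmf : (m.factorial : ℝ) ≠ 0 := by exact_mod_cast m.factorial_ne_zero
  generalize a ^ k = A at *
  generalize b ^ k = B at *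
  generalize a ^ (d - k + 1) = A' at *
  generalize b ^ (m - k + 1) = B' at *
  field_simp

theorem logNorm_eq {m d : ℕ} (hd : 0 < d) (hdm : d ≤ m) {p : ℝ[X]} (hp : p.Monic)
    (hdeg : p.natDegree = d) (hsplit : p.Splits) (hroots : ∀ x ∈ p.roots, 0 ≤ x) {r t : ℝ}
    (hr : 0 < r) (ht : 0 < t)
    (hpos : 0 < normLaplace (momentCoeff m d p) d d m (Real.sqrt ((m : ℝ) * d))
      (Real.sqrt (maxRoot p)) r t) :
    logNorm m d p r t = 1 / Real.sqrt ((m : ℝ) * d) *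
      (Real.log (d.factorial * m.factorial) - (d + 1) * Real.log (Real.sqrt ((m : ℝ) * d) * r) -
        (m + 1) * Real.log (Real.sqrt ((m : ℝ) * d) * t) +
        Real.log (normLaplace (momentCoeff m d p) d d m (Real.sqrt ((m : ℝ) * d))
          (Real.sqrt (maxRoot p)) r t)) := by
  have hq0 : 0 < Real.sqrt ((m : ℝ) * d) := sqrt_mul_pos hd hdm
  have h1 := pow_pos (mul_pos hq0 hr) (d + 1)
  have h2 := pow_pos (mul_pos hq0 ht) (m + 1)
  have h3 : (0 : ℝ) < d.factorial * m.factorial := by positivity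
  rw [logNorm, lqNorm, integral_exp_mul_fkDet hd hdm hp hdeg hsplit hroots hr ht,
    Real.log_rpow (mul_pos (div_pos h3 (mul_pos h1 h2)) hpos),
    Real.log_mul (div_pos h3 (mul_pos h1 h2)).ne' hpos.ne',
    Real.log_div h3.ne' (mul_pos h1 h2).ne', Real.log_mul h1.ne' h2.ne', Real.log_pow, Real.log_pow]
  push_cast
  ring

theorem deriv_logNorm_fst {m d : ℕ} (hd : 0 < d) (hdm : d ≤ m) {p : ℝ[X]} (hp : p.Monic)
    (hdeg : p.natDegree = d) (hsplit : p.Splits) (hroots : ∀ x ∈ p.roots, 0 ≤ x) {r t : ℝ}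
    (hr : 0 < r) (ht : 0 < t)
    (hpos : 0 < normLaplace (momentCoeff m d p) d d m (Real.sqrt ((m : ℝ) * d))
      (Real.sqrt (maxRoot p)) r t) :
    deriv (fun r => logNorm m d p r t) r = 1 / (Real.sqrt ((m : ℝ) * d) * r) *
      (normLaplaceDeriv (momentCoeff m d p) d d m (Real.sqrt ((m : ℝ) * d))
          (Real.sqrt (maxRoot p)) r t /
        normLaplace (momentCoeff m d p) d d m (Real.sqrt ((m : ℝ) * d))
          (Real.sqrt (maxRoot p)) r t - (d + 1)) := by
  have hq0 : 0 < Real.sqrt ((m : ℝ) * d) := sqrt_mul_pos hd hdm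
  have hΦ := hasDerivAt_normLaplace (momentCoeff m d p) d d m (Real.sqrt ((m : ℝ) * d))
    (Real.sqrt (maxRoot p)) hr.ne' t
  have hlog : HasDerivAt (fun r => Real.log (Real.sqrt ((m : ℝ) * d) * r)) (1 / r) r := by
    refine (((hasDerivAt_id r).const_mul (Real.sqrt ((m : ℝ) * d))).log
      (mul_pos hq0 hr).ne').congr_deriv ?_
    simp only [id]
    field_simp
  have h := ((((hlog.const_mul ((d : ℝ) + 1)).const_sub
    (Real.log (d.factorial * m.factorial))).sub_const
      ((m + 1) * Real.log (Real.sqrt ((m : ℝ) * d) * t))).add (hΦ.log hpos.ne')).const_mul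
        (1 / Real.sqrt ((m : ℝ) * d))
  refine (HasDerivAt.congr_of_eventuallyEq h ?_).deriv.trans ?_
  -- The closed form of `logNorm` needs r > 0 and Φ > 0, which are open conditions.
  · filter_upwards [lt_mem_nhds hr, hΦ.continuousAt.eventually (lt_mem_nhds hpos)] with r' hr' hpos'
    exact logNorm_eq hd hdm hp hdeg hsplit hroots hr' ht hpos'
  · field_simp
    ring

theorem deriv_logNorm_snd {m d : ℕ} (hd : 0 < d) (hdm : d ≤ m) {p : ℝ[X]} (hp : p.Monic)
    (hdeg : p.natDegree = d) (hsplit : p.Splits) (hroots : ∀ x ∈ p.roots, 0 ≤ x) {r t : ℝ}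
    (hr : 0 < r) (ht : 0 < t)
    (hpos : 0 < normLaplace (momentCoeff m d p) d d m (Real.sqrt ((m : ℝ) * d))
      (Real.sqrt (maxRoot p)) r t) :
    deriv (fun t => logNorm m d p r t) t = 1 / (Real.sqrt ((m : ℝ) * d) * t) *
      (normLaplaceDeriv (momentCoeff m d p) d m d (Real.sqrt ((m : ℝ) * d))
          (Real.sqrt (maxRoot p)) t r /
        normLaplace (momentCoeff m d p) d d m (Real.sqrt ((m : ℝ) * d))
          (Real.sqrt (maxRoot p)) r t - (m + 1)) := by
  have hq0 : 0 < Real.sqrt ((m : ℝ) * d) := sqrt_mul_pos hd hdm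
  have hΦ := hasDerivAt_normLaplace (momentCoeff m d p) d m d (Real.sqrt ((m : ℝ) * d))
    (Real.sqrt (maxRoot p)) ht.ne' r
  simp only [fun x => normLaplace_swap (momentCoeff m d p) d m d (Real.sqrt ((m : ℝ) * d))
    (Real.sqrt (maxRoot p)) x r] at hΦ
  have hlog : HasDerivAt (fun t => Real.log (Real.sqrt ((m : ℝ) * d) * t)) (1 / t) t := by
    refine (((hasDerivAt_id t).const_mul (Real.sqrt ((m : ℝ) * d))).log
      (mul_pos hq0 ht).ne').congr_deriv ?_
    simp only [id]
    field_simp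
  have h := (((hlog.const_mul ((m : ℝ) + 1)).const_sub
    (Real.log (d.factorial * m.factorial) -
      (d + 1) * Real.log (Real.sqrt ((m : ℝ) * d) * r))).add (hΦ.log hpos.ne')).const_mul
        (1 / Real.sqrt ((m : ℝ) * d))
  refine (HasDerivAt.congr_of_eventuallyEq h ?_).deriv.trans ?_
  · filter_upwards [lt_mem_nhds ht, hΦ.continuousAt.eventually (lt_mem_nhds hpos)] with t' ht' hpos'
    exact logNorm_eq hd hdm hp hdeg hsplit hroots hr ht' hpos'
  · field_simp
    ring

/-! ### The Cauchy transform -/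

/-- The Cauchy transform of the symmetrized root measure as a sum over the roots. -/
noncomputable def rootCauchy (d : ℕ) (p : ℝ[X]) (z : ℝ) : ℝ :=
  (d : ℝ)⁻¹ * (p.roots.map fun x => z / (z ^ 2 - x)).sum

theorem integral_sum_dirac_pair (s : Multiset ℝ) (f : ℝ → ℝ) :
    Integrable f (s.map fun x => Measure.dirac (Real.sqrt x) + Measure.dirac (-Real.sqrt x)).sum ∧
    ∫ u, f u ∂(s.map fun x => Measure.dirac (Real.sqrt x) + Measure.dirac (-Real.sqrt x)).sum =
      (s.map fun x => f (Real.sqrt x) + f (-Real.sqrt x)).sum := by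
  have hdirac : ∀ a : ℝ, Integrable f (Measure.dirac a) := fun a =>
    integrable_dirac enorm_lt_top
  induction s using Multiset.induction_on with
  | empty => simp
  | cons x s ih =>
    simp only [Multiset.map_cons, Multiset.sum_cons]
    refine ⟨((hdirac _).add_measure (hdirac _)).add_measure ih.1, ?_⟩
    rw [integral_add_measure ((hdirac _).add_measure (hdirac _)) ih.1,
      integral_add_measure (hdirac _) (hdirac _), ih.2, integral_dirac, integral_dirac]

theorem sub_pos_of_sqrt_maxRoot_lt {p : ℝ[X]} {z x : ℝ}
    (hz : Real.sqrt (maxRoot p) < z) (hx : x ∈ p.roots) : 0 < z ^ 2 - x := by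
  have h := (Real.sqrt_lt' ((Real.sqrt_nonneg _).trans_lt hz)).1 hz
  linarith [le_maxRoot hx]

/-- The two atoms ±√x combine: 1/(z - √x) + 1/(z + √x) = 2z/(z² - x). -/
theorem cauchyTransform_eq {d : ℕ} {p : ℝ[X]} (hroots : ∀ x ∈ p.roots, 0 ≤ x) {z : ℝ}
    (hz : Real.sqrt (maxRoot p) < z) :
    cauchyTransform (symmMeasure d p) z = rootCauchy d p z := by
  rw [cauchyTransform, symmMeasure, integral_smul_measure, (integral_sum_dirac_pair _ _).2,
    rootCauchy]
  have h : (p.roots.map fun x => 1 / (z - Real.sqrt x) + 1 / (z - -Real.sqrt x)) =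
      p.roots.map fun x => 2 * (z / (z ^ 2 - x)) := by
    refine Multiset.map_congr rfl fun x hx => ?_
    have h1 := sub_pos_of_sqrt_maxRoot_lt hz hx
    have h2 := Real.mul_self_sqrt (hroots x hx)
    have h3 : z ^ 2 - x = (z - Real.sqrt x) * (z + Real.sqrt x) := by linear_combination h2
    rw [h3] at h1 ⊢
    have h4 := left_ne_zero_of_mul h1.ne'
    have h5 := right_ne_zero_of_mul h1.ne'
    rw [sub_neg_eq_add]
    field_simp
    ring
  rw [h, Multiset.sum_map_mul_left, smul_eq_mul, ENNReal.toReal_inv, ENNReal.toReal_mul,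
    ENNReal.toReal_natCast, ENNReal.toReal_ofNat, mul_inv]
  ring

/-! ### Monotonicity and injectivity of the rectangular Cauchy transform -/

section Monotone

variable {d : ℕ} {p : ℝ[X]}

theorem rootCauchy_pos (hd : 0 < d) (hcard : Multiset.card p.roots = d) {z : ℝ}
    (hz : Real.sqrt (maxRoot p) < z) : 0 < rootCauchy d p z := by
  have hz0 := (Real.sqrt_nonneg _).trans_lt hz
  refine mul_pos (by positivity) ?_
  have hne : p.roots ≠ ∅ := by
    intro h
    rw [h] at hcard
    exact hd.ne hcard
  have := Multiset.sum_lt_sum_of_nonempty (f := fun _ => (0 : ℝ)) hne fun x hx =>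
    div_pos hz0 (sub_pos_of_sqrt_maxRoot_lt hz hx)
  simpa using this

theorem rootCauchy_strictAnti (hd : 0 < d) (hcard : Multiset.card p.roots = d)
    (hroots : ∀ x ∈ p.roots, 0 ≤ x) :
    StrictAntiOn (rootCauchy d p) (Set.Ioi (Real.sqrt (maxRoot p))) := by
  intro z hz w hw hzw
  have hz0 := (Real.sqrt_nonneg _).trans_lt (Set.mem_Ioi.1 hz)
  have hw0 := hz0.trans hzw
  have hne : p.roots ≠ ∅ := by
    intro h
    rw [h] at hcard
    exact hd.ne hcard
  refine mul_lt_mul_of_pos_left ?_ (by positivity)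
  refine Multiset.sum_lt_sum_of_nonempty hne fun x hx => ?_
  rw [div_lt_div_iff₀ (sub_pos_of_sqrt_maxRoot_lt hw hx) (sub_pos_of_sqrt_maxRoot_lt hz hx)]
  -- After cross-multiplication the difference is zw(w - z) + x(w - z), whose second term is
  -- nonnegative because x ≥ 0.
  have h1 : 0 < z * w * (w - z) := by
    have := sub_pos.2 hzw
    positivity
  have h2 : 0 ≤ x * (w - z) := mul_nonneg (hroots x hx) (sub_pos.2 hzw).le
  nlinarith

theorem rectCauchy_eq {m : ℕ} (hroots : ∀ x ∈ p.roots, 0 ≤ x) {z : ℝ}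
    (hz : Real.sqrt (maxRoot p) < z) :
    rectCauchy m d p z = rootCauchy d p z *
      (lam m d * rootCauchy d p z + (1 - lam m d) * (1 / z)) := by
  rw [rectCauchy, cauchyTransform_eq hroots hz]

theorem rectCauchy_injOn {m : ℕ} (hd : 0 < d) (hdm : d ≤ m) (hcard : Multiset.card p.roots = d)
    (hroots : ∀ x ∈ p.roots, 0 ≤ x) :
    Set.InjOn (rectCauchy m d p) (Set.Ioi (Real.sqrt (maxRoot p))) := by
  have hlam := lam_pos hd hdm
  have hlam1 : lam m d ≤ 1 :=
    div_le_one_of_le₀ (by exact_mod_cast hdm) (by positivity)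
  refine StrictAntiOn.injOn fun z hz w hw hzw => ?_
  have hz0 := (Real.sqrt_nonneg _).trans_lt (Set.mem_Ioi.1 hz)
  have hw0 := hz0.trans hzw
  rw [rectCauchy_eq hroots hz, rectCauchy_eq hroots hw]
  have h1 := rootCauchy_strictAnti hd hcard hroots hz hw hzw
  have h2 := rootCauchy_pos hd hcard hw
  have h3 : 1 / w ≤ 1 / z := one_div_le_one_div_of_le hz0 hzw.le
  have h4 : (1 - lam m d) * (1 / w) ≤ (1 - lam m d) * (1 / z) :=
    mul_le_mul_of_nonneg_left h3 (by linarith)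
  have h5 : 0 ≤ (1 - lam m d) * (1 / w) := mul_nonneg (by linarith) (by positivity)
  have h6 := mul_lt_mul_of_pos_left h1 hlam
  exact mul_lt_mul'' h1 (by linarith) h2.le (by positivity)

/-- Injectivity suffices: the saddle points are later produced explicitly, so surjectivity of the
rectangular Cauchy transform is never used. -/
theorem rectCauchyInv_rectCauchy {m : ℕ} (hd : 0 < d) (hdm : d ≤ m)
    (hcard : Multiset.card p.roots = d) (hroots : ∀ x ∈ p.roots, 0 ≤ x) {z : ℝ}
    (hz : Real.sqrt (maxRoot p) < z) : rectCauchyInv m d p (rectCauchy m d p z) = z :=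
  (rectCauchy_injOn hd hdm hcard hroots).leftInvOn_invFunOn (Set.mem_Ioi.2 hz)

end Monotone

/-! ### Derivatives of the potential on the diagonal -/

section Potential

variable {m d : ℕ} {p : ℝ[X]}

theorem fkPotential_eq {x y : ℝ} (hy : 0 < y) (hxy : 0 < p.eval (x * y)) :
    fkPotential m d p x y = -((1 - lam m d) / Real.sqrt (lam m d) * Real.log y +
      Real.sqrt (lam m d) * (1 / (d : ℝ) * Real.log (p.eval (x * y)))) := by
  have h1 := Real.rpow_pos_of_pos hy ((1 - lam m d) / Real.sqrt (lam m d))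
  have h2 := Real.rpow_pos_of_pos hxy (1 / (d : ℝ))
  have h3 := Real.rpow_pos_of_pos h2 (Real.sqrt (lam m d))
  rw [fkPotential, fkDet, Real.log_mul h1.ne' h3.ne', Real.log_rpow hy, Real.log_rpow h2,
    Real.log_rpow hxy]

theorem eval_mul_self_pos (hp : p.Monic) (hsplit : p.Splits) {z : ℝ}
    (hz : Real.sqrt (maxRoot p) < z) : 0 < p.eval (z * z) := by
  refine eval_pos_of_maxRoot_lt hp hsplit ?_
  have h := (Real.sqrt_lt' ((Real.sqrt_nonneg _).trans_lt hz)).1 hz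
  rwa [sq] at h

/-- The logarithmic derivative p'/p at w = z² is the sum of 1/(w - x) over the roots x. -/
theorem mul_derivative_div_eval (hp : p.Monic) (hsplit : p.Splits) {z : ℝ}
    (hz : Real.sqrt (maxRoot p) < z) :
    1 / (d : ℝ) * (p.derivative.eval (z * z) * z / p.eval (z * z)) = rootCauchy d p z := by
  rw [mul_div_right_comm,
    hsplit.eval_derivative_div_eval_of_ne_zero (eval_mul_self_pos hp hsplit hz).ne', rootCauchy,
    ← Multiset.sum_map_mul_right, one_div]
  congr 3
  funext x
  rw [sq]
  ring

theorem deriv_fkPotential_fst (hp : p.Monic) (hsplit : p.Splits) {z : ℝ}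
    (hz : Real.sqrt (maxRoot p) < z) :
    -deriv (fun x => fkPotential m d p x z) z = Real.sqrt (lam m d) * rootCauchy d p z := by
  have hz0 := (Real.sqrt_nonneg _).trans_lt hz
  have hpos := eval_mul_self_pos hp hsplit hz
  have hp' : HasDerivAt (fun x => p.eval (x * z)) (p.derivative.eval (z * z) * z) z := by
    exact HasDerivAt.comp (h := fun x => x * z) z (p.hasDerivAt (z * z)) (hasDerivAt_mul_const z)
  have h := ((((hp'.log hpos.ne').const_mul (1 / (d : ℝ))).const_mul
    (Real.sqrt (lam m d))).const_add
      ((1 - lam m d) / Real.sqrt (lam m d) * Real.log z)).neg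
  have he : (fun x => fkPotential m d p x z) =ᶠ[nhds z] fun x =>
      -((1 - lam m d) / Real.sqrt (lam m d) * Real.log z +
        Real.sqrt (lam m d) * (1 / (d : ℝ) * Real.log (p.eval (x * z)))) := by
    filter_upwards [hp'.continuousAt.eventually (lt_mem_nhds hpos)] with x hx
    exact fkPotential_eq hz0 hx
  rw [(HasDerivAt.congr_of_eventuallyEq h he).deriv, neg_neg,
    mul_derivative_div_eval hp hsplit hz]

theorem deriv_fkPotential_snd (hp : p.Monic) (hsplit : p.Splits) {z : ℝ}
    (hz : Real.sqrt (maxRoot p) < z) :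
    -deriv (fun y => fkPotential m d p z y) z =
      (1 - lam m d) / Real.sqrt (lam m d) * (1 / z) +
        Real.sqrt (lam m d) * rootCauchy d p z := by
  have hz0 := (Real.sqrt_nonneg _).trans_lt hz
  have hpos := eval_mul_self_pos hp hsplit hz
  have hp' : HasDerivAt (fun y => p.eval (z * y)) (p.derivative.eval (z * z) * z) z := by
    exact HasDerivAt.comp (h := fun y => z * y) z (p.hasDerivAt (z * z)) (hasDerivAt_const_mul z)
  have h := ((((hasDerivAt_id z).log hz0.ne').const_mul
    ((1 - lam m d) / Real.sqrt (lam m d))).add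
      (((hp'.log hpos.ne').const_mul (1 / (d : ℝ))).const_mul (Real.sqrt (lam m d)))).neg
  have he : (fun y => fkPotential m d p z y) =ᶠ[nhds z] fun y =>
      -((1 - lam m d) / Real.sqrt (lam m d) * Real.log y +
        Real.sqrt (lam m d) * (1 / (d : ℝ) * Real.log (p.eval (z * y)))) := by
    filter_upwards [hp'.continuousAt.eventually (lt_mem_nhds hpos), lt_mem_nhds hz0] with y hy hy0
    exact fkPotential_eq hy0 hy
  rw [(HasDerivAt.congr_of_eventuallyEq h he).deriv, neg_neg,
    mul_derivative_div_eval hp hsplit hz]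
  rfl

end Potential

/-! ### The saddle point as an analytic function of `s` -/

/-- The function `(1/d) ∑ᵢ 1 / (1 - λᵢ v)`, so that the Cauchy transform is `u g(u²)` at `1 / u`. -/
noncomputable def rootSeries (d : ℕ) (p : ℝ[X]) (v : ℝ) : ℝ :=
  (d : ℝ)⁻¹ * (p.roots.map fun x => (1 - x * v)⁻¹).sum

theorem analyticAt_multiset_sum (s : Multiset ℝ) {f : ℝ → ℝ → ℝ} {v : ℝ}
    (h : ∀ x ∈ s, AnalyticAt ℝ (f x) v) : AnalyticAt ℝ (fun v => (s.map fun x => f x v).sum) v := by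
  induction s using Multiset.induction_on with
  | empty => simpa using analyticAt_const
  | cons x s ih =>
    simp only [Multiset.map_cons, Multiset.sum_cons]
    exact (h x (Multiset.mem_cons_self x s)).fun_add
      (ih fun y hy => h y (Multiset.mem_cons_of_mem hy))

theorem analyticAt_rootSeries (d : ℕ) (p : ℝ[X]) : AnalyticAt ℝ (rootSeries d p) 0 := by
  unfold rootSeries
  refine analyticAt_const.fun_mul (analyticAt_multiset_sum _ fun x _ => ?_)
  exact (analyticAt_const.fun_sub (analyticAt_const.fun_mul analyticAt_id)).fun_inv (by simp)

theorem rootSeries_zero {d : ℕ} (hd : 0 < d) {p : ℝ[X]} (hcard : Multiset.card p.roots = d) :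
    rootSeries d p 0 = 1 := by
  have hd0 : (d : ℝ) ≠ 0 := by exact_mod_cast hd.ne'
  simp [rootSeries, hcard, hd0]

theorem rootCauchy_one_div {d : ℕ} {p : ℝ[X]} {u : ℝ} (hu : 0 < u) :
    rootCauchy d p (1 / u) = u * rootSeries d p (u ^ 2) := by
  rw [rootCauchy, rootSeries, mul_left_comm, ← Multiset.sum_map_mul_left (a := u)]
  congr 3
  funext x
  rw [show (1 / u) ^ 2 - x = (1 - x * u ^ 2) / u ^ 2 by field_simp, div_div_eq_mul_div]
  rw [div_eq_mul_inv]
  congr 1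
  field_simp

theorem analyticAt_sqrt {x : ℝ} (hx : x ≠ 0) : AnalyticAt ℝ Real.sqrt x :=
  (Real.contDiffAt_sqrt hx).analyticAt

/-- The function u √(h u) is analytic with derivative 1 at 0, so the analytic inverse function
theorem applies. -/
theorem analyticAt_uniformizer {h : ℝ → ℝ} (hh : AnalyticAt ℝ h 0) (h0 : h 0 = 1) :
    ∃ ψ : ℝ → ℝ, AnalyticAt ℝ ψ 0 ∧ ψ 0 = 0 ∧
      ∀ᶠ s in nhds (0 : ℝ), ψ s * Real.sqrt (h (ψ s)) = s := by
  set φ : ℝ → ℝ := fun u => u * Real.sqrt (h u) with hφ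
  have hsqrt : AnalyticAt ℝ (fun u => Real.sqrt (h u)) 0 :=
    (analyticAt_sqrt (by rw [h0]; exact one_ne_zero)).comp hh
  have hφa : AnalyticAt ℝ φ 0 := analyticAt_id.fun_mul hsqrt
  have hφ0 : φ 0 = 0 := zero_mul _
  have hderiv : deriv φ 0 = 1 := by
    have := ((hasDerivAt_id (0 : ℝ)).mul hsqrt.differentiableAt.hasDerivAt).deriv
    refine this.trans ?_
    simp [h0]
  have hne : deriv φ 0 ≠ 0 := by rw [hderiv]; exact one_ne_zero
  refine ⟨hφa.hasStrictDerivAt.localInverse _ _ _ hne, ?_, ?_, ?_⟩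
  · have := hφa.analyticAt_localInverse hne
    rwa [hφ0] at this
  · have := HasStrictFDerivAt.localInverse_apply_image
      (hφa.hasStrictDerivAt.hasStrictFDerivAt_equiv hne)
    rwa [hφ0] at this
  · have := HasStrictDerivAt.eventually_right_inverse hφa.hasStrictDerivAt hne
    rwa [hφ0] at this

/-- Near `0+`, the points `r(s)` and `t(s)` are given by analytic functions with product `s²`. -/
theorem exists_analytic_points {m d : ℕ} (hd : 0 < d) (hdm : d ≤ m) {p : ℝ[X]} (hp : p.Monic)
    (hdeg : p.natDegree = d) (hsplit : p.Splits) (hroots : ∀ x ∈ p.roots, 0 ≤ x) :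
    ∃ r t : ℝ → ℝ, AnalyticAt ℝ r 0 ∧ AnalyticAt ℝ t 0 ∧ r 0 = 0 ∧ t 0 = 0 ∧
      (∀ᶠ s in nhds (0 : ℝ), r s * t s = s ^ 2) ∧
      ∀ᶠ s in nhdsWithin (0 : ℝ) (Set.Ioi 0),
        0 < r s ∧ 0 < t s ∧ rPoint m d p s = r s ∧ tPoint m d p s = t s := by
  have hcard : Multiset.card p.roots = d := by
    rw [← hdeg]; exact (Polynomial.splits_iff_card_roots.1 hsplit)
  have hlam := lam_pos hd hdm
  have hlam1 : lam m d ≤ 1 := div_le_one_of_le₀ (by exact_mod_cast hdm) (by positivity)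
  have hsl := Real.sqrt_pos.2 hlam
  set g : ℝ → ℝ := fun u => rootSeries d p (u ^ 2) with hg
  have hga : AnalyticAt ℝ g 0 := by
    refine AnalyticAt.comp (g := rootSeries d p) (f := fun u : ℝ => u ^ 2) ?_ (by fun_prop)
    rw [show (0 : ℝ) ^ 2 = 0 by norm_num]
    exact analyticAt_rootSeries d p
  have hg0 : g 0 = 1 := by
    rw [hg]
    simpa using rootSeries_zero hd hcard
  -- In the coordinate u = 1/z, the rectangular Cauchy transform is u² h(u), so H = s² becomes u √(h
  -- u) = s.
  set h : ℝ → ℝ := fun u => g u * (lam m d * g u + (1 - lam m d)) with hh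
  have hha : AnalyticAt ℝ h 0 := by fun_prop
  have hh0 : h 0 = 1 := by
    rw [hh]
    simp [hg0]
  obtain ⟨ψ, hψa, hψ0, hψ⟩ := analyticAt_uniformizer hha hh0
  have hψt : Filter.Tendsto ψ (nhds 0) (nhds 0) := by
    have := hψa.continuousAt.tendsto
    rwa [hψ0] at this
  have hgψ : AnalyticAt ℝ (fun s => g (ψ s)) 0 :=
    AnalyticAt.comp (g := g) (by rwa [hψ0]) hψa
  have hsq : ∀ᶠ s in nhds (0 : ℝ), ψ s ^ 2 * h (ψ s) = s ^ 2 := by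
    have h1 : ∀ᶠ s in nhds (0 : ℝ), 0 < h (ψ s) := by
      refine hψt.eventually (hha.continuousAt.eventually (lt_mem_nhds ?_))
      rw [hh0]; exact one_pos
    filter_upwards [hψ, h1] with s h2 h3
    conv_rhs => rw [← h2, mul_pow, Real.sq_sqrt h3.le]
  -- These are √λ G(z) and (1-λ)/(√λ z) + √λ G(z) at z = 1/ψ(s); their product is H(z).
  refine ⟨fun s => Real.sqrt (lam m d) * (ψ s * g (ψ s)),
    fun s => (1 - lam m d) / Real.sqrt (lam m d) * ψ s + Real.sqrt (lam m d) * (ψ s * g (ψ s)),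
    analyticAt_const.fun_mul (hψa.fun_mul hgψ),
    (analyticAt_const.fun_mul hψa).fun_add (analyticAt_const.fun_mul (hψa.fun_mul hgψ)),
    by simp [hψ0], by simp [hψ0], ?_, ?_⟩
  · filter_upwards [hsq] with s hs
    rw [← hs, hh]
    have := Real.mul_self_sqrt hlam.le
    field_simp
    linear_combination (ψ s ^ 2 * g (ψ s) ^ 2) * this
  · have hR : ∀ᶠ s in nhds (0 : ℝ), ψ s * Real.sqrt (maxRoot p) < 1 := by
      have : Filter.Tendsto (fun s => ψ s * Real.sqrt (maxRoot p)) (nhds 0) (nhds 0) := by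
        simpa using hψt.mul_const (Real.sqrt (maxRoot p))
      exact this.eventually (gt_mem_nhds one_pos)
    have hgpos : ∀ᶠ s in nhds (0 : ℝ), 0 < g (ψ s) := by
      refine hψt.eventually (hga.continuousAt.eventually (lt_mem_nhds ?_))
      rw [hg0]; exact one_pos
    filter_upwards [nhdsWithin_le_nhds hψ, nhdsWithin_le_nhds hsq, nhdsWithin_le_nhds hR,
      nhdsWithin_le_nhds hgpos, self_mem_nhdsWithin] with s h1 h2 h3 h4 hs
    have hψpos : 0 < ψ s := by
      have : 0 < ψ s * Real.sqrt (h (ψ s)) := by rw [h1]; exact hs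
      exact pos_of_mul_pos_left this (Real.sqrt_nonneg _)
    have hz : Real.sqrt (maxRoot p) < 1 / ψ s := by
      rw [lt_div_iff₀ hψpos, mul_comm]
      exact h3
    have hJ : rectCauchyInv m d p (s ^ 2) = 1 / ψ s := by
      rw [← rectCauchyInv_rectCauchy hd hdm hcard hroots hz]
      congr 1
      rw [rectCauchy_eq hroots hz, rootCauchy_one_div hψpos, ← h2, hh, one_div_one_div]
      ring
    have hr : 0 < Real.sqrt (lam m d) * (ψ s * g (ψ s)) := by positivity
    refine ⟨hr, ?_, ?_, ?_⟩
    · have : 0 ≤ (1 - lam m d) / Real.sqrt (lam m d) * ψ s :=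
        mul_nonneg (div_nonneg (by linarith) hsl.le) hψpos.le
      linarith
    · rw [rPoint, hJ, deriv_fkPotential_fst hp hsplit hz, rootCauchy_one_div hψpos]
    · rw [tPoint, hJ, deriv_fkPotential_snd hp hsplit hz, rootCauchy_one_div hψpos,
        one_div_one_div]

open Asymptotics

/-! ### Expansions at `0` modulo a power of `s` -/

theorem pow_isBigO_pow {i j : ℕ} (hij : i ≤ j) :
    (fun s : ℝ => s ^ j) =O[nhds 0] fun s => s ^ i := by
  obtain ⟨k, rfl⟩ := Nat.exists_eq_add_of_le hij
  have h : (fun s : ℝ => s ^ k) =O[nhds 0] fun _ => (1 : ℝ) :=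
    (continuous_pow k).continuousAt.isBigO_one ℝ
  simpa only [pow_add, mul_one] using (isBigO_refl (fun s : ℝ => s ^ i) (nhds 0)).mul h

theorem mul_isBigO_of_continuousAt {f g h : ℝ → ℝ} (hf : f =O[nhds 0] h)
    (hg : ContinuousAt g 0) : (fun s => g s * f s) =O[nhds 0] h := by
  simpa using (hg.isBigO_one ℝ).mul hf

theorem gammaTail_comp_sub_one_isBigO (n : ℕ) (c : ℝ) {r : ℝ → ℝ} (hr : AnalyticAt ℝ r 0)
    (hr0 : r 0 = 0) :
    (fun s => gammaTail n (c * r s) - 1) =O[nhds 0] (fun s => s ^ (n + 1)) ∧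
    (fun s => (c * r s) ^ (n + 1)) =O[nhds 0] fun s => s ^ (n + 1) := by
  have h1 : (fun s => c * r s) =O[nhds 0] fun s => s := by
    have := hr.differentiableAt.hasDerivAt.isBigO_sub
    simp only [hr0, sub_zero] at this
    exact this.const_mul_left c
  have h2 : Filter.Tendsto (fun s => c * r s) (nhds 0) (nhds 0) := by
    have := (hr.continuousAt.tendsto).const_mul c
    rwa [hr0, mul_zero] at this
  exact ⟨((gammaTail_sub_one_isBigO n).comp_tendsto h2).trans (h1.pow (n + 1)), h1.pow (n + 1)⟩

theorem analyticAt_gammaTail_comp (n : ℕ) (c : ℝ) {r : ℝ → ℝ} (hr : AnalyticAt ℝ r 0) :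
    AnalyticAt ℝ (fun s => gammaTail n (c * r s)) 0 :=
  AnalyticAt.comp (g := gammaTail n) (analyticAt_gammaTail n _) (analyticAt_const.fun_mul hr)

section Asymptotics

variable {b : ℕ → ℝ} {N n₁ n₂ : ℕ} {q ρ : ℝ} {r t : ℝ → ℝ}

theorem analyticAt_normLaplace (hr : AnalyticAt ℝ r 0) (ht : AnalyticAt ℝ t 0) :
    AnalyticAt ℝ (fun s => normLaplace b N n₁ n₂ q ρ (r s) (t s)) 0 := by
  unfold normLaplace
  refine Finset.analyticAt_fun_sum _ fun k _ => ?_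
  have h1 := analyticAt_gammaTail_comp (n₁ - k) (q * ρ) hr
  have h2 := analyticAt_gammaTail_comp (n₂ - k) (q * ρ) ht
  have h3 : AnalyticAt ℝ (fun s => b k * (q ^ 2 * (r s * t s)) ^ k) 0 := by fun_prop
  exact h3.fun_mul (h1.fun_mul h2)

theorem analyticAt_normLaplaceDeriv (hr : AnalyticAt ℝ r 0) (ht : AnalyticAt ℝ t 0) :
    AnalyticAt ℝ (fun s => normLaplaceDeriv b N n₁ n₂ q ρ (r s) (t s)) 0 := by
  unfold normLaplaceDeriv
  refine Finset.analyticAt_fun_sum _ fun k _ => ?_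
  have h1 := analyticAt_gammaTail_comp (n₁ - k) (q * ρ) hr
  have h2 := analyticAt_gammaTail_comp (n₂ - k) (q * ρ) ht
  have h3 : AnalyticAt ℝ (fun s => b k * (q ^ 2 * (r s * t s)) ^ k) 0 := by fun_prop
  have h4 : AnalyticAt ℝ (fun s => Real.exp (-(q * ρ * r s)) *
    ((q * ρ * r s) ^ (n₁ - k + 1) / (n₁ - k).factorial)) 0 := by fun_prop
  exact h3.fun_mul (((analyticAt_const.fun_mul h1).fun_sub h4).fun_mul h2)

/-- Of the factor s^(2k), half raises the error from order N - k + 1 to N + 1; the other half is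
merely bounded. -/
theorem term_sub_isBigO (hrt : ∀ᶠ s in nhds (0 : ℝ), r s * t s = s ^ 2) {k : ℕ} (hk : k ≤ N)
    (β τ : ℝ) {T : ℝ → ℝ} (hT : (fun s => T s - τ) =O[nhds 0] fun s => s ^ (N - k + 1)) :
    (fun s => β * (q ^ 2 * (r s * t s)) ^ k * T s - β * (q ^ 2 * s ^ 2) ^ k * τ) =O[nhds 0]
      fun s => s ^ (N + 1) := by
  have h1 : (fun s : ℝ => β * (q ^ 2) ^ k * s ^ k * s ^ k) =O[nhds 0] fun s => s ^ k :=
    mul_isBigO_of_continuousAt (g := fun s => β * (q ^ 2) ^ k * s ^ k)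
      (isBigO_refl _ _) (by fun_prop)
  refine (h1.mul hT).congr' ?_ ?_
  · filter_upwards [hrt] with s hs
    rw [hs]
    ring
  · refine Filter.Eventually.of_forall fun s => ?_
    simp only
    rw [← pow_add]
    congr 1
    omega

theorem tail_mul_tail_sub_one_isBigO (hr : AnalyticAt ℝ r 0) (hr0 : r 0 = 0)
    (ht : AnalyticAt ℝ t 0) (ht0 : t 0 = 0) (hn₁ : N ≤ n₁) (hn₂ : N ≤ n₂) (k : ℕ) :
    (fun s => gammaTail (n₁ - k) (q * ρ * r s) * gammaTail (n₂ - k) (q * ρ * t s) - 1)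
      =O[nhds 0] fun s => s ^ (N - k + 1) := by
  have h1 := (gammaTail_comp_sub_one_isBigO (n₁ - k) (q * ρ) hr hr0).1.trans
    (pow_isBigO_pow (show N - k + 1 ≤ n₁ - k + 1 by omega))
  have h2 := (gammaTail_comp_sub_one_isBigO (n₂ - k) (q * ρ) ht ht0).1.trans
    (pow_isBigO_pow (show N - k + 1 ≤ n₂ - k + 1 by omega))
  have h3 := (analyticAt_gammaTail_comp (n₂ - k) (q * ρ) ht).continuousAt
  refine ((mul_isBigO_of_continuousAt h1 h3).add h2).congr_left fun s => ?_
  ring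

theorem normLaplace_isBigO (hr : AnalyticAt ℝ r 0) (hr0 : r 0 = 0)
    (ht : AnalyticAt ℝ t 0) (ht0 : t 0 = 0) (hrt : ∀ᶠ s in nhds (0 : ℝ), r s * t s = s ^ 2)
    (hn₁ : N ≤ n₁) (hn₂ : N ≤ n₂) :
    (fun s => normLaplace b N n₁ n₂ q ρ (r s) (t s) -
      ∑ k ∈ Finset.range (N + 1), b k * (q ^ 2 * s ^ 2) ^ k) =O[nhds 0] fun s => s ^ (N + 1) := by
  simp only [normLaplace, ← Finset.sum_sub_distrib]
  refine IsBigO.fun_sum fun k hk => ?_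
  have := term_sub_isBigO (q := q) hrt (Nat.lt_succ_iff.1 (Finset.mem_range.1 hk)) (b k) 1
    (tail_mul_tail_sub_one_isBigO (q := q) (ρ := ρ) hr hr0 ht ht0 hn₁ hn₂ k)
  simpa only [mul_one] using this

theorem normLaplaceDeriv_isBigO (hr : AnalyticAt ℝ r 0) (hr0 : r 0 = 0)
    (ht : AnalyticAt ℝ t 0) (ht0 : t 0 = 0) (hrt : ∀ᶠ s in nhds (0 : ℝ), r s * t s = s ^ 2)
    (hn₁ : N ≤ n₁) (hn₂ : N ≤ n₂) :
    (fun s => normLaplaceDeriv b N n₁ n₂ q ρ (r s) (t s) -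
      ∑ k ∈ Finset.range (N + 1), b k * (q ^ 2 * s ^ 2) ^ k * k) =O[nhds 0]
        fun s => s ^ (N + 1) := by
  simp only [normLaplaceDeriv, ← Finset.sum_sub_distrib]
  refine IsBigO.fun_sum fun k hk => ?_
  refine term_sub_isBigO (q := q) hrt (Nat.lt_succ_iff.1 (Finset.mem_range.1 hk)) (b k) k ?_
  have h1 := (tail_mul_tail_sub_one_isBigO (q := q) (ρ := ρ) hr hr0 ht ht0 hn₁ hn₂ k).const_mul_left
    (k : ℝ)
  -- The extra term from differentiating the incomplete gamma function is itself of order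
  -- s^(n₁-k+1).
  have h2 := (gammaTail_comp_sub_one_isBigO (n₁ - k) (q * ρ) hr hr0).2.trans
    (pow_isBigO_pow (show N - k + 1 ≤ n₁ - k + 1 by omega))
  have h3 : ContinuousAt (fun s => Real.exp (-(q * ρ * r s)) / (n₁ - k).factorial *
      gammaTail (n₂ - k) (q * ρ * t s)) 0 := by
    have h4 : AnalyticAt ℝ (fun s => Real.exp (-(q * ρ * r s)) / ((n₁ - k).factorial : ℝ)) 0 := by
      fun_prop
    exact (h4.fun_mul (analyticAt_gammaTail_comp (n₂ - k) (q * ρ) ht)).continuousAt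
  refine (h1.sub (mul_isBigO_of_continuousAt h2 h3)).congr_left fun s => ?_
  ring

end Asymptotics

/-! ### The truncated Laplace polynomial and the R-transform at s² -/

section Polynomial

variable {m d : ℕ} {p : ℝ[X]}

theorem eval_laplacePoly {q : ℝ} (hq : q ^ 2 = m * d) (s : ℝ) :
    (laplacePoly m d p).eval (s ^ 2) =
      ∑ k ∈ Finset.range (d + 1), momentCoeff m d p k * (q ^ 2 * s ^ 2) ^ k := by
  rw [laplacePoly, Polynomial.eval_finsetSum]
  refine Finset.sum_congr rfl fun k _ => ?_
  rw [Polynomial.eval_mul, Polynomial.eval_C, Polynomial.eval_pow, Polynomial.eval_X, hq,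
    mul_pow ((m : ℝ) * d), mul_assoc]

theorem eval_X_mul_derivative_laplacePoly {q : ℝ} (hq : q ^ 2 = m * d) (s : ℝ) :
    s ^ 2 * (laplacePoly m d p).derivative.eval (s ^ 2) =
      ∑ k ∈ Finset.range (d + 1), momentCoeff m d p k * (q ^ 2 * s ^ 2) ^ k * k := by
  rw [laplacePoly, Polynomial.derivative_sum, Polynomial.eval_finsetSum, Finset.mul_sum]
  refine Finset.sum_congr rfl fun k _ => ?_
  rw [Polynomial.derivative_C_mul_X_pow, Polynomial.eval_mul, Polynomial.eval_C,
    Polynomial.eval_pow, Polynomial.eval_X, hq, mul_pow ((m : ℝ) * d)]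
  rcases k with _ | k
  · simp
  · rw [Nat.add_sub_cancel, pow_succ (s ^ 2)]
    ring

/-- Divisibility by w^(d+1) at w = s² gives order 2(d+1), of which only d + 1 is needed. -/
theorem realR_laplacePoly_isBigO (hd : 0 < d) (hp : p.Monic) (hdeg : p.natDegree = d) :
    (fun s : ℝ => d * (realR m d p).eval (s ^ 2) * (laplacePoly m d p).eval (s ^ 2) +
      s ^ 2 * (laplacePoly m d p).derivative.eval (s ^ 2)) =O[nhds 0] fun s => s ^ (d + 1) := by
  obtain ⟨W, hW⟩ := X_pow_dvd_realR (m := m) hd hp hdeg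
  have h : (fun s : ℝ => s ^ (d + 1) * W.eval (s ^ 2) * s ^ (d + 1)) =O[nhds 0]
      fun s => s ^ (d + 1) :=
    mul_isBigO_of_continuousAt (g := fun s => s ^ (d + 1) * W.eval (s ^ 2)) (isBigO_refl _ _)
      (by fun_prop)
  refine h.congr_left fun s => ?_
  have := congrArg (Polynomial.eval (s ^ 2)) hW
  simp only [Polynomial.eval_add, Polynomial.eval_mul, Polynomial.eval_C, Polynomial.eval_X,
    Polynomial.eval_pow] at this
  rw [this]
  ring

theorem eval_zero_laplacePoly (hp : p.Monic) (hdeg : p.natDegree = d) :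
    (laplacePoly m d p).eval 0 = 1 := by
  rw [← Polynomial.coeff_zero_eq_eval_zero, coeff_laplacePoly _ _ _ (Nat.zero_le _),
    momentCoeff_zero hp hdeg]
  simp

theorem eq_zero_of_isBigO_pow {f : ℝ → ℝ} {n : ℕ} (h : f =O[nhds 0] fun s => s ^ (n + 1)) :
    f 0 = 0 := by
  obtain ⟨C, hC⟩ := h.bound
  simpa using hC.self_of_nhds

theorem eval_zero_realR (hd : 0 < d) (hp : p.Monic) (hdeg : p.natDegree = d) :
    (realR m d p).eval 0 = 0 := by
  have h := eq_zero_of_isBigO_pow (realR_laplacePoly_isBigO (m := m) hd hp hdeg)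
  simpa [eval_zero_laplacePoly hp hdeg, hd.ne'] using h

end Polynomial

/-- A quotient `A / Φ` agrees with `-d N(s²)` modulo `s^(d+1)` as soon as its numerator and
denominator agree with `s² P'(s²)` and `P(s²)`. -/
theorem div_add_realR_isBigO {m d : ℕ} (hd : 0 < d) {p : ℝ[X]} (hp : p.Monic)
    (hdeg : p.natDegree = d) {A Φ : ℝ → ℝ} (hΦ : ContinuousAt Φ 0)
    (hΦP : (fun s => Φ s - (laplacePoly m d p).eval (s ^ 2)) =O[nhds 0] fun s => s ^ (d + 1))
    (hAP : (fun s => A s - s ^ 2 * (laplacePoly m d p).derivative.eval (s ^ 2)) =O[nhds 0]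
      fun s => s ^ (d + 1)) :
    0 < Φ 0 ∧ (fun s => A s / Φ s + d * (realR m d p).eval (s ^ 2)) =O[nhds 0]
      fun s => s ^ (d + 1) := by
  have hΦ0 : 0 < Φ 0 := by
    have := eq_zero_of_isBigO_pow hΦP
    simp only [ne_eq, OfNat.ofNat_ne_zero, not_false_eq_true, zero_pow,
      eval_zero_laplacePoly hp hdeg, sub_eq_zero] at this
    rw [this]
    exact one_pos
  refine ⟨hΦ0, ?_⟩
  have h1 := realR_laplacePoly_isBigO (m := m) hd hp hdeg
  -- With P = `laplacePoly m d p` and N = `realR m d p`: Φ (A/Φ + dN) = (A - s²P') + dN (Φ - P) +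
  -- (dNP + s²P').
  have h2 := mul_isBigO_of_continuousAt (g := fun s => d * (realR m d p).eval (s ^ 2)) hΦP
    (by fun_prop)
  have h3 := mul_isBigO_of_continuousAt ((hAP.add h2).add h1) (hΦ.inv₀ hΦ0.ne')
  refine h3.congr' ?_ Filter.EventuallyEq.rfl
  filter_upwards [hΦ.eventually (lt_mem_nhds hΦ0)] with s hs
  simp only [Pi.inv_apply]
  field_simp
  ring

/-! ### The expansion of `K` -/

/-- Near `0+` the function `K` is analytic and agrees with `((d + m) / 2 + 1) / d + N(s²)`
modulo `s^(d+1)`, where `N` is the finite `R`-transform. -/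
theorem exists_kTransform_expansion {m d : ℕ} (hd : 0 < d) (hdm : d ≤ m) {p : ℝ[X]}
    (hp : p.Monic) (hdeg : p.natDegree = d) (hsplit : p.Splits)
    (hroots : ∀ x ∈ p.roots, 0 ≤ x) :
    ∃ κ : ℝ → ℝ, AnalyticAt ℝ κ 0 ∧
      (∀ᶠ s in nhdsWithin (0 : ℝ) (Set.Ioi 0), kTransform m d p s = κ s) ∧
      (fun s => κ s - ((((d : ℝ) + m) / 2 + 1) / d + (realR m d p).eval (s ^ 2))) =O[nhds 0]
        fun s => s ^ (d + 1) := by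
  obtain ⟨r, t, hr, ht, hr0, ht0, hrt, hpts⟩ :=
    exists_analytic_points hd hdm hp hdeg hsplit hroots
  set q := Real.sqrt ((m : ℝ) * d) with hq
  set ρ := Real.sqrt (maxRoot p) with hρ
  set b := momentCoeff m d p with hb
  have hd0 : (0 : ℝ) < d := by exact_mod_cast hd
  have hm0 : (0 : ℝ) < m := by exact_mod_cast hd.trans_le hdm
  have hq0 : 0 < q := sqrt_mul_pos hd hdm
  have hqq : q ^ 2 = m * d := Real.sq_sqrt (by positivity)
  set N : ℝ → ℝ := fun s => (realR m d p).eval (s ^ 2) with hN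
  set Φ : ℝ → ℝ := fun s => normLaplace b d d m q ρ (r s) (t s) with hΦdef
  set A : ℝ → ℝ := fun s => normLaplaceDeriv b d d m q ρ (r s) (t s) with hAdef
  set B : ℝ → ℝ := fun s => normLaplaceDeriv b d m d q ρ (t s) (r s) with hBdef
  have hΦ : AnalyticAt ℝ Φ 0 := analyticAt_normLaplace hr ht
  have hA : AnalyticAt ℝ A 0 := analyticAt_normLaplaceDeriv hr ht
  have hB : AnalyticAt ℝ B 0 := analyticAt_normLaplaceDeriv ht hr
  have htr : ∀ᶠ s in nhds (0 : ℝ), t s * r s = s ^ 2 := by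
    filter_upwards [hrt] with s hs
    rw [mul_comm, hs]
  have hΦP : (fun s => Φ s - (laplacePoly m d p).eval (s ^ 2)) =O[nhds 0]
      fun s => s ^ (d + 1) := by
    simp only [eval_laplacePoly hqq]
    exact normLaplace_isBigO hr hr0 ht ht0 hrt le_rfl hdm
  obtain ⟨hΦ0, hU⟩ := div_add_realR_isBigO (A := A) hd hp hdeg hΦ.continuousAt hΦP (by
    simp only [eval_X_mul_derivative_laplacePoly hqq]
    exact normLaplaceDeriv_isBigO hr hr0 ht ht0 hrt le_rfl hdm)
  obtain ⟨-, hV⟩ := div_add_realR_isBigO (A := B) hd hp hdeg hΦ.continuousAt hΦP (by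
    simp only [eval_X_mul_derivative_laplacePoly hqq]
    exact normLaplaceDeriv_isBigO ht ht0 hr hr0 htr hdm le_rfl)
  set M : ℝ → ℝ := fun s => (((d : ℝ) + m) / 2 + 1) / d + N s with hM
  have hNa : AnalyticAt ℝ N 0 := by
    have h1 := AnalyticAt.aeval_polynomial (𝕜 := ℝ) (f := fun s : ℝ => s ^ 2) (z := 0) (by fun_prop)
      (realR m d p)
    simpa only [Polynomial.coe_aeval_eq_eval] using h1
  have hMa : AnalyticAt ℝ M 0 := analyticAt_const.fun_add hNa
  have hM0 : 0 < M 0 := by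
    have : N 0 = 0 := by simpa [hN] using eval_zero_realR (m := m) hd hp hdeg
    rw [hM]
    simp only [this, add_zero]
    positivity
  -- This is K²: the factor 1/(q² r t) from the two derivatives cancels s² and turns 1/λ into 1/d².
  set κ₂ : ℝ → ℝ := fun s => ((d : ℝ) ^ 2)⁻¹ *
    ((A s / Φ s - (d + 1)) * (B s / Φ s - (m + 1)) + ((m : ℝ) - d) ^ 2 / 4) with hκ₂
  have hUa : AnalyticAt ℝ (fun s => A s / Φ s) 0 := hA.fun_div hΦ hΦ0.ne'
  have hVa : AnalyticAt ℝ (fun s => B s / Φ s) 0 := hB.fun_div hΦ hΦ0.ne'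
  have hκ₂a : AnalyticAt ℝ κ₂ 0 :=
    analyticAt_const.fun_mul (((hUa.fun_sub analyticAt_const).fun_mul
      (hVa.fun_sub analyticAt_const)).fun_add analyticAt_const)
  -- Completing the square gives d²M² = (dN+d+1)(dN+m+1) + (m-d)²/4. With U = A/Φ and V = B/Φ, d²(κ₂
  -- - M²) = (U + dN)(V - (m+1)) - (dN+d+1)(V + dN).
  have hdiff : (fun s => κ₂ s - M s ^ 2) =O[nhds 0] fun s => s ^ (d + 1) := by
    have h1 := mul_isBigO_of_continuousAt (g := fun s => ((d : ℝ) ^ 2)⁻¹ * (B s / Φ s - (m + 1)))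
      hU (analyticAt_const.fun_mul (hVa.fun_sub analyticAt_const)).continuousAt
    have h2 := mul_isBigO_of_continuousAt (g := fun s => -(((d : ℝ) ^ 2)⁻¹ * (d * N s + (d + 1))))
      hV (analyticAt_const.fun_mul ((analyticAt_const.fun_mul hNa).fun_add
        analyticAt_const)).fun_neg.continuousAt
    refine (h1.add h2).congr_left fun s => ?_
    simp only [hκ₂, hM, hN]
    field_simp
    ring
  have hκ₂0 : 0 < κ₂ 0 := by
    have := eq_zero_of_isBigO_pow hdiff
    rw [sub_eq_zero] at this
    rw [this]
    positivity
  have hκa : AnalyticAt ℝ (fun s => Real.sqrt (κ₂ s)) 0 := (analyticAt_sqrt hκ₂0.ne').comp hκ₂a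
  refine ⟨fun s => Real.sqrt (κ₂ s), hκa, ?_, ?_⟩
  · filter_upwards [hpts, nhdsWithin_le_nhds hrt,
      nhdsWithin_le_nhds (hΦ.continuousAt.eventually (lt_mem_nhds hΦ0)), self_mem_nhdsWithin] with
      s hs hrts hΦs hs0
    obtain ⟨hrs, hts, hrP, htP⟩ := hs
    have hs0' : s ≠ 0 := ne_of_gt hs0
    rw [kTransform, finiteInv, hrP, htP,
      deriv_logNorm_fst hd hdm hp hdeg hsplit hroots hrs hts hΦs,
      deriv_logNorm_snd hd hdm hp hdeg hsplit hroots hrs hts hΦs]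
    change Real.sqrt (1 / lam m d * s ^ 2 * (1 / (q * r s) * (A s / Φ s - (d + 1)) *
      (1 / (q * t s) * (B s / Φ s - (m + 1)))) + _) = _
    congr 1
    have h1 : 1 / (q * r s) * (A s / Φ s - (d + 1)) * (1 / (q * t s) * (B s / Φ s - (m + 1))) =
        (A s / Φ s - (d + 1)) * (B s / Φ s - (m + 1)) / (m * d * s ^ 2) := by
      rw [← hqq, ← hrts]
      field_simp
    rw [h1, hκ₂, lam]
    simp only
    generalize A s / Φ s = U
    generalize B s / Φ s = V
    field_simp
  -- Uses √κ₂ - M = (κ₂ - M²)/(√κ₂ + M), whose denominator is positive near 0.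
  · have hpos : 0 < Real.sqrt (κ₂ 0) + M 0 := by positivity
    have hcont : ContinuousAt (fun s => (Real.sqrt (κ₂ s) + M s)⁻¹) 0 :=
      ((hκa.fun_add hMa).continuousAt).inv₀ hpos.ne'
    refine (mul_isBigO_of_continuousAt hdiff hcont).congr' ?_ Filter.EventuallyEq.rfl
    filter_upwards [hκ₂a.continuousAt.eventually (lt_mem_nhds hκ₂0),
      hMa.continuousAt.eventually (lt_mem_nhds hM0)] with s h1 h2
    have h3 := Real.sqrt_nonneg (κ₂ s)
    have h4 : Real.sqrt (κ₂ s) + M s ≠ 0 := by positivity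
    have h5 := Real.sq_sqrt h1.le
    rw [inv_mul_eq_iff_eq_mul₀ h4]
    linear_combination -h5

/-! ### Coefficients of convergent power series -/

/-- Once the coefficients below k vanish, divide by s^k and let s → 0 through nonzero values: the
quotient tends to the k-th coefficient and is O(s^(n-k)). -/
theorem coeff_eq_zero_of_isBigO {n : ℕ} (P : ℝ[X])
    (h : (fun s => P.eval s) =O[nhds 0] fun s => s ^ n) {k : ℕ} (hk : k < n) : P.coeff k = 0 := by
  induction k using Nat.strong_induction_on with
  | _ k ih =>
    obtain ⟨Q, hQ⟩ := Polynomial.X_pow_dvd_iff.2 fun j (hj : j < k) => ih j hj (hj.trans hk)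
    have hPk : P.coeff k = Q.eval 0 := by
      rw [hQ, Polynomial.coeff_X_pow_mul', if_pos le_rfl, Nat.sub_self,
        Polynomial.coeff_zero_eq_eval_zero]
    obtain ⟨C, hC⟩ := h.bound
    have hlim : Filter.Tendsto (fun s : ℝ => C * ‖s ^ (n - k)‖)
        (nhdsWithin 0 {0}ᶜ) (nhds 0) := by
      have : Continuous fun s : ℝ => C * ‖s ^ (n - k)‖ := by fun_prop
      have h0 := (this.tendsto 0).mono_left (nhdsWithin_le_nhds (s := {0}ᶜ))
      simpa [show n - k ≠ 0 by omega] using h0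
    have hQlim : Filter.Tendsto (fun s : ℝ => Q.eval s) (nhdsWithin 0 {0}ᶜ) (nhds (Q.eval 0)) :=
      Q.continuous.continuousAt.tendsto.mono_left nhdsWithin_le_nhds
    have hbound : ∀ᶠ s in nhdsWithin (0 : ℝ) {0}ᶜ, ‖Q.eval s‖ ≤ C * ‖s ^ (n - k)‖ := by
      filter_upwards [nhdsWithin_le_nhds hC, self_mem_nhdsWithin] with s hs hs0
      have hpos : 0 < ‖s ^ k‖ := norm_pos_iff.2 (pow_ne_zero k hs0)
      rw [hQ, Polynomial.eval_mul, Polynomial.eval_pow, Polynomial.eval_X, norm_mul,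
        show n = k + (n - k) by omega, pow_add, norm_mul] at hs
      refine le_of_mul_le_mul_left ?_ hpos
      linarith
    rw [hPk]
    exact tendsto_nhds_unique hQlim (squeeze_zero_norm' hbound hlim)

theorem exists_expansion_of_isBigO {κ : ℝ → ℝ} (hκ : AnalyticAt ℝ κ 0) (n : ℕ) (P : ℝ[X])
    (h : (fun s => κ s - P.eval s) =O[nhds 0] fun s => s ^ n) :
    ∃ f : ℝ⟦X⟧, HasExpansion κ f ∧ ∀ k < n, PowerSeries.coeff k f = P.coeff k := by
  obtain ⟨c, hc⟩ := hκ
  refine ⟨PowerSeries.mk fun k => c.coeff k, ?_, fun k hk => ?_⟩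
  · have h1 : ∀ᶠ s in nhds (0 : ℝ), HasSum (fun k : ℕ => c.coeff k * s ^ k) (κ s) := by
      have := hasFPowerSeriesAt_iff.1 hc
      filter_upwards [this] with s hs
      simpa [mul_comm] using hs
    obtain ⟨ε, hε, hball⟩ := Metric.eventually_nhds_iff.1 h1
    refine ⟨ε, hε, fun s hs0 hs => ?_⟩
    simp only [PowerSeries.coeff_mk]
    refine hball ?_
    rw [Real.dist_eq, sub_zero, abs_of_pos hs0]
    exact hs
  · have h2 := hc.isBigO_sub_partialSum_pow n
    simp only [zero_add] at h2
    have h3 : (fun s : ℝ => κ s - c.partialSum n s) =O[nhds 0] fun s => s ^ n :=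
      h2.trans (IsBigO.of_bound 1 (Filter.Eventually.of_forall fun s => by simp))
    have h4 : ∀ s : ℝ, (∑ k ∈ Finset.range n, Polynomial.C (c.coeff k) * Polynomial.X ^ k :
        ℝ[X]).eval s = c.partialSum n s := by
      intro s
      rw [Polynomial.eval_finsetSum, FormalMultilinearSeries.partialSum]
      refine Finset.sum_congr rfl fun k _ => ?_
      rw [FormalMultilinearSeries.apply_eq_pow_smul_coeff, Polynomial.eval_mul, Polynomial.eval_C,
        Polynomial.eval_pow, Polynomial.eval_X, smul_eq_mul, mul_comm]
    -- The Taylor partial sum and P both approximate κ to order s^n, so their difference is a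
    -- polynomial of size O(s^n).
    have h5 := coeff_eq_zero_of_isBigO
      ((∑ k ∈ Finset.range n, Polynomial.C (c.coeff k) * Polynomial.X ^ k) - P)
      ((h.sub h3).congr_left fun s => by rw [Polynomial.eval_sub, h4]; ring) hk
    rw [Polynomial.coeff_sub, sub_eq_zero, Polynomial.finsetSum_coeff] at h5
    rw [PowerSeries.coeff_mk, ← h5]
    simp only [Polynomial.coeff_C_mul_X_pow]
    simp [hk]

end RectFree

/-! ### Subtraction of the reference transform and comparison of coefficients -/

theorem mainTheorem4 (m d : ℕ) (hd : 0 < d) (hdm : d ≤ m) (p : Polynomial ℝ) (hp : p.Monic)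
    (hdeg : p.natDegree = d) (hsplit : p.Splits) (hroots : ∀ x ∈ p.roots, 0 ≤ x) :
    ∃ f : PowerSeries ℝ, RectFree.HasExpansion (RectFree.modifiedR m d p) f ∧
      RectFree.ModTrunc (d + 1) (PowerSeries.map Complex.ofRealHom f)
        (((RectFree.finiteR m d p).comp (Polynomial.X ^ 2) : Polynomial ℂ) : PowerSeries ℂ) := by
  obtain ⟨κ, hκa, hκ, hκO⟩ :=
    RectFree.exists_kTransform_expansion hd hdm hp hdeg hsplit hroots
  obtain ⟨κ₀, hκ₀a, hκ₀, hκ₀O⟩ := RectFree.exists_kTransform_expansion (m := m) hd hdm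
    (Polynomial.monic_X_pow (R := ℝ) d) (Polynomial.natDegree_X_pow d)
    (Polynomial.Splits.X_pow d) (by
      intro x hx
      have hx0 := (Polynomial.mem_roots'.1 hx).2
      rw [Polynomial.IsRoot, Polynomial.eval_pow, Polynomial.eval_X] at hx0
      exact (pow_eq_zero_iff hd.ne' |>.1 hx0).ge)
  obtain ⟨f, ⟨ε, hε, hf⟩, hcoeff⟩ := RectFree.exists_expansion_of_isBigO
    (hκa.fun_sub hκ₀a) (d + 1) ((RectFree.realR m d p).comp (Polynomial.X ^ 2))
    ((hκO.sub hκ₀O).congr_left fun s => by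
      rw [RectFree.realR_X_pow, Polynomial.eval_comp, Polynomial.eval_pow, Polynomial.eval_X,
        Polynomial.eval_zero]
      ring)
  refine ⟨f, ?_, ?_⟩
  -- The analytic functions agree with the K-transforms only for small s > 0, so the radius of
  -- convergence is cut down to δ.
  · obtain ⟨δ, hδ, hδs⟩ := mem_nhdsGT_iff_exists_Ioo_subset.1 (hκ.and hκ₀)
    refine ⟨min ε δ, lt_min hε hδ, fun s hs0 hs => ?_⟩
    have h := hδs ⟨hs0, hs.trans_le (min_le_right _ _)⟩
    rw [RectFree.modifiedR, h.1, h.2]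
    exact hf s hs0 (hs.trans_le (min_le_left _ _))
  · rw [RectFree.ModTrunc, ← RectFree.map_realR hd hdm hp hdeg]
    have hX : (Polynomial.X ^ 2 : Polynomial ℂ) =
        (Polynomial.X ^ 2 : Polynomial ℝ).map Complex.ofRealHom := by
      rw [Polynomial.map_pow, Polynomial.map_X]
    rw [hX, ← Polynomial.map_comp]
    ext k
    rw [PowerSeries.coeff_trunc, PowerSeries.coeff_trunc]
    split_ifs with hk
    · rw [PowerSeries.coeff_map, hcoeff k hk, Polynomial.coeff_coe, Polynomial.coeff_map]
    · rfl
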